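/- For a finite positive Borel measure $\rho$ of compact support on $\mathbb{C}$ let $\mathcal{E}(\rho)=\iint \log|z-w|^{-1}\,d\rho(z)\,d\rho(w)\in(-\infty,+\infty]$. The capacity of a compact set $K\subset\mathbb{C}$ is $C(K)=\exp(-\inf\mathcal{E}(\rho))$, the infimum being over all Borel probability measures $\rho$ on $K$ (so $C(K)=0$ if all of them have infinite energy). For open $U\subset\mathbb{C}$ put $C(U)=\sup\{C(K): K\subset U,\ K\text{ compact}\}$, and say that a bounded Borel set $X$ has capacity zero if $\inf\{C(U): X\subset U,\ U\text{ open}\}=0$. If $C(K)>0$, the equilibrium measure $\rho_K$ of $K$ is the unique probability measure on $K$ with $\mathcal{E}(\rho_K)=\log (C(K)^{-1})$. Theorem. Let $\mu$ be a finite positive Borel measure on $\mathbb{R}$ with compact support $E$ such that $C(E)>0$. Let $P_n$ be its monic orthogonal polynomials, $p_n=P_n/\|P_n\|_{L^2(\mu)}$, and $\{a_n,b_n\}_{n\ge 1}$ its Jacobi parameters, so that $$x\,p_n(x)=a_{n+1}p_{n+1}(x)+b_{n+1}p_n(x)+a_np_{n-1}(x),\qquad a_n>0,$$ where $p_{-1}=0$.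 Let $\nu_n=\frac1n\sum_{j=1}^n\delta_{z_j}$ be the normalized zero counting measure of $P_n$, where $z_1,\dots,z_n$ are the zeros of $P_n$ with multiplicity. Let $n(1)<n(2)<\cdots$ be a subsequence such that $\nu_{n(j)}$ converges weakly to the equilibrium measure $\rho_E$ of $E$. Then either (a) $\displaystyle\lim_{j\to\infty}(a_1\cdots a_{n(j)})^{1/n(j)}=C(E)$, or (b) $\mu$ is carried by a set of capacity zero, that is, there is a Borel set $X\subset E$ of capacity zero with $\mu(\mathbb{R}\setminus X)=0$. -/

import Mathlib

open MeasureTheory Filter Topology Polynomial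
open scoped ENNReal BoundedContinuousFunction

namespace PotentialTheory

/-- The logarithmic kernel `log |z - w|⁻¹` on the complex plane, with the value `+∞` on the
diagonal `z = w`. -/
noncomputable def logKernel (z w : ℂ) : EReal :=
  ENNReal.log (edist z w)⁻¹

/-- The integral of an extended real valued function, as the difference of the integrals of its
positive and of its negative part. (It is used only for functions that are bounded below on the
support of a finite measure, so that the second integral is finite.) -/
noncomputable def extIntegral {α : Type*} [MeasurableSpace α] (μ : Measure α) (f : α → EReal) :
    EReal :=
  ((∫⁻ x, (f x).toENNReal ∂μ : ℝ≥0∞) : EReal) - ((∫⁻ x, (-(f x)).toENNReal ∂μ : ℝ≥0∞) : EReal)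

/-- The Coulomb energy `∬ log |z - w|⁻¹ dρ(z) dρ(w)`; the value `+∞` is allowed. -/
noncomputable def energy (ρ : Measure ℂ) : EReal :=
  extIntegral (ρ.prod ρ) (fun p => logKernel p.1 p.2)

/-- `ρ` is a Borel probability measure on the set `K`. -/
def IsProbabilityOn (K : Set ℂ) (ρ : Measure ℂ) : Prop :=
  IsProbabilityMeasure ρ ∧ ρ Kᶜ = 0

/-- The logarithmic capacity `exp (- inf 𝓔(ρ))` of a compact set `K`, the infimum running over
the probability measures on `K`. It is `0` if all of these have energy `+∞`. -/
noncomputable def compactCapacity (K : Set ℂ) : ℝ≥0∞ :=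
  EReal.exp (-(⨅ (ρ : Measure ℂ) (_ : IsProbabilityOn K ρ), energy ρ))

/-- The capacity of an open set: the supremum of the capacities of its compact subsets. -/
noncomputable def openCapacity (U : Set ℂ) : ℝ≥0∞ :=
  ⨆ (K : Set ℂ) (_ : IsCompact K) (_ : K ⊆ U), compactCapacity K

/-- The capacity of a bounded Borel set: the infimum of the capacities of the open sets
that contain it. -/
noncomputable def capacity (X : Set ℂ) : ℝ≥0∞ :=
  ⨅ (U : Set ℂ) (_ : IsOpen U) (_ : X ⊆ U), openCapacity U

/-- `ρ` is the equilibrium measure of the compact set `K`: the set `K` has positive capacity, and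
`ρ` is the probability measure on `K` whose energy is `log (C(K)⁻¹)`, the least possible one. -/
structure IsEquilibriumMeasure (K : Set ℂ) (ρ : Measure ℂ) : Prop where
  capacity_pos : 0 < compactCapacity K
  isProbabilityOn : IsProbabilityOn K ρ
  energy_eq : energy ρ = ENNReal.log (compactCapacity K)⁻¹

end PotentialTheory

namespace OrthogonalPolynomials

/-- The monic orthogonal polynomials `P_n` of a measure on the real line, by the Gram-Schmidt
process applied to `1, x, x², …` in `L²(μ)`. -/
noncomputable def monicOP (μ : Measure ℝ) (n : ℕ) : ℝ[X] :=
  X ^ n - ∑ k : Fin n,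
    C ((∫ x, x ^ n * (monicOP μ k).eval x ∂μ) / (∫ x, (monicOP μ k).eval x ^ 2 ∂μ)) * monicOP μ k
termination_by n
decreasing_by all_goals exact k.2

/-- The orthonormal polynomials `p_n = P_n / ‖P_n‖`, with the norm of `L²(μ)`. -/
noncomputable def orthonormalOP (μ : Measure ℝ) (n : ℕ) : ℝ[X] :=
  C (Real.sqrt (∫ x, (monicOP μ n).eval x ^ 2 ∂μ))⁻¹ * monicOP μ n

/-- The off-diagonal Jacobi parameters: `jacobiA μ k` is the coefficient `a_{k+1}` in
`x p_n = a_{n+1} p_{n+1} + b_{n+1} p_n + a_n p_{n-1}`, that is, the matrix element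
`⟨p_{k+1}, x p_k⟩` of multiplication by `x` in the orthonormal basis `(p_n)` of `L²(μ)`. -/
noncomputable def jacobiA (μ : Measure ℝ) (k : ℕ) : ℝ :=
  ∫ x, (orthonormalOP μ (k + 1)).eval x * (x * (orthonormalOP μ k).eval x) ∂μ

/-- The geometric mean `(a_1 ⋯ a_n)^{1/n}`. -/
noncomputable def jacobiMean (μ : Measure ℝ) (n : ℕ) : ℝ :=
  (∏ k ∈ Finset.range n, jacobiA μ k) ^ ((1 : ℝ) / n)

/-- The normalized zero counting measure `n⁻¹ ∑ δ_{z_j}` of a polynomial of degree `n`, where the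
`z_j` are its complex zeros, repeated according to multiplicity. -/
noncomputable def zeroMeasure (P : ℂ[X]) : Measure ℂ :=
  (P.natDegree : ℝ≥0∞)⁻¹ • (P.roots.map (fun z => Measure.dirac z)).sum

/-- The zero counting measure `ν_n` of the `n`-th orthogonal polynomial. -/
noncomputable def opZeroMeasure (μ : Measure ℝ) (n : ℕ) : Measure ℂ :=
  zeroMeasure ((monicOP μ n).map (algebraMap ℝ ℂ))

end OrthogonalPolynomials

/-! Let `E` be the support of `μ`, regarded in the plane, and let `U^σ(z) = ∫ log⁺(d/|z-w|) dσ(w)`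
with `d` larger than the diameter of `E`. If `κ` is the least energy for this nonnegative kernel,
then `C(E) = d e^{-κ}`. The product `a_1 ⋯ a_n` telescopes to `‖P_n‖/‖P_0‖` (`jacobiA_eq_div`), so
the question is the root asymptotics of `‖P_n‖`.

The upper bound holds along all `n`: `P_n` has the least norm among monic polynomials, and
comparison with Fekete polynomials, whose size on `E` is controlled by the energy of the uniform
measure on the Fekete points, gives `limsup ≤ C(E)` (`exists_normOP_le`).

Suppose that the limit fails to be `C(E)`. Then `‖P_n‖` is at most a constant times `A^n` along a
subsequence, with `A < C(E)`. For `A < b < C(E)`, Markov's inequality and Borel-Cantelli show that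
`μ`-almost every `x` eventually satisfies `|P_n(x)| ≤ b^n`, which says that `U^{ν_n}(x) ≥ log(d/b) >
κ`. On the other hand `U^ρ ≤ κ` on all of `E`, by `ae_lintegral_kern_eq` and the maximum principle
`lintegral_kern_le_of_mem_real`. Since `ν_n → ρ` weakly, a compact set on which `U^{ν_n}` eventually
exceeds `κ` by a fixed amount carries no measure of finite energy
(`kernEnergy_eq_top_of_potential_gt`): integrate against such a measure, cut down so that its
potential is almost continuous, and exchange the integrals.

Thus `μ` is carried by countably many compact sets of capacity zero. Capacity in the conclusion is
an outer one, defined by open sets; weak compactness (`exists_truncated_energy_gt`) and a pigeonhole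
argument (`capacity_iUnion_eq_zero`) pass to it. -/

namespace PotentialTheory

open scoped NNReal

/-! ### The nonnegative logarithmic kernel and its truncations. -/

/-- The nonnegative kernel `log⁺ (d / |z - w|)`, infinite on the diagonal. -/
noncomputable def kern (d : ℝ) (z w : ℂ) : ℝ≥0∞ :=
  if z = w then ⊤ else ENNReal.ofReal (Real.log (d / ‖z - w‖))

/-- The truncation `log (d / max |z - w| (d / (m + 1)))⁺` of `kern d` at height `log (m + 1)`. -/
noncomputable def tkern (d : ℝ) (m : ℕ) (z w : ℂ) : ℝ≥0 :=
  (Real.log (d / max ‖z - w‖ (d / (m + 1)))).toNNReal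

/-- The energy of a measure with respect to `kern d`. -/
noncomputable def kernEnergy (d : ℝ) (ρ : Measure ℂ) : ℝ≥0∞ :=
  ∫⁻ z, ∫⁻ w, kern d z w ∂ρ ∂ρ

lemma kern_comm (d : ℝ) (z w : ℂ) : kern d z w = kern d w z := by
  unfold kern; rw [norm_sub_rev]; simp only [eq_comm]

lemma kern_self (d : ℝ) (z : ℂ) : kern d z z = ⊤ := by simp [kern]

/-- Splits the kernel into a bounded continuous part and a singular part of range `d / (m + 1)`.
Outside that range the second term vanishes; inside it the first is the constant `log (m + 1)`. -/
lemma kern_eq_tkern_add {d : ℝ} (hd : 0 < d) (m : ℕ) (z w : ℂ) :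
    kern d z w = tkern d m z w + kern (d / (m + 1)) z w := by
  by_cases h : z = w
  · simp [kern, h]
  have hr : 0 < ‖z - w‖ := norm_pos_iff.2 (sub_ne_zero.2 h)
  have hm : (0 : ℝ) < m + 1 := by positivity
  simp only [kern, h, if_false, tkern]
  change _ = ENNReal.ofReal _ + _
  rcases le_total ‖z - w‖ (d / (m + 1)) with h1 | h1
  · rw [max_eq_right h1, ← ENNReal.ofReal_add]
    · congr 1
      rw [← Real.log_mul (by positivity) (by positivity)]
      congr 1
      field_simp
    · apply Real.log_nonneg
      rw [div_div_cancel₀ hd.ne']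
      linarith [(Nat.cast_nonneg m : (0 : ℝ) ≤ m)]
    · apply Real.log_nonneg
      rw [le_div_iff₀ hr]; linarith
  · rw [max_eq_left h1, ENNReal.ofReal_of_nonpos (p := Real.log (d / (m + 1) / ‖z - w‖)), add_zero]
    apply Real.log_nonpos (by positivity)
    rw [div_le_one hr]; exact h1

lemma tkern_le_kern {d : ℝ} (hd : 0 < d) (m : ℕ) (z w : ℂ) : (tkern d m z w : ℝ≥0∞) ≤ kern d z w := by
  rw [kern_eq_tkern_add hd m]; exact le_self_add

lemma tkern_mono {d : ℝ} (hd : 0 < d) (z w : ℂ) : Monotone fun m => tkern d m z w := by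
  intro m n hmn
  have : (m : ℝ) ≤ n := by exact_mod_cast hmn
  apply Real.toNNReal_le_toNNReal
  have h1 : 0 < d / ((m : ℝ) + 1) := by positivity
  have h2 : 0 < d / ((n : ℝ) + 1) := by positivity
  gcongr

lemma tkern_le {d : ℝ} (hd : 0 < d) (m : ℕ) (z w : ℂ) : (tkern d m z w : ℝ) ≤ Real.log (m + 1) := by
  have hm : (0 : ℝ) < m + 1 := by positivity
  rw [tkern, Real.coe_toNNReal']
  have h1 : 0 < d / ((m : ℝ) + 1) := by positivity
  refine max_le (Real.log_le_log (by positivity) ?_) (Real.log_nonneg (by simp))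
  rw [div_le_iff₀ (lt_max_of_lt_right h1)]
  calc d = (m + 1) * (d / (m + 1)) := by field_simp
    _ ≤ _ := by gcongr; exact le_max_right _ _

lemma tkern_self {d : ℝ} (hd : 0 < d) (m : ℕ) (z : ℂ) :
    (tkern d m z z : ℝ≥0∞) = ENNReal.ofReal (Real.log (m + 1)) := by
  have h1 : 0 < d / ((m : ℝ) + 1) := by positivity
  change ENNReal.ofReal _ = _
  rw [sub_self, norm_zero, max_eq_right h1.le, div_div_cancel₀ hd.ne']

lemma tendsto_log_succ : Tendsto (fun m : ℕ => ENNReal.ofReal (Real.log (m + 1))) atTop (𝓝 ⊤) :=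
  ENNReal.tendsto_ofReal_nhds_top.2
    (Real.tendsto_log_atTop.comp (tendsto_natCast_atTop_atTop.atTop_add tendsto_const_nhds))

lemma kern_eq_iSup {d : ℝ} (hd : 0 < d) (z w : ℂ) :
    kern d z w = ⨆ m, (tkern d m z w : ℝ≥0∞) := by
  apply le_antisymm _ (iSup_le fun m => tkern_le_kern hd m z w)
  by_cases h : z = w
  · subst h
    rw [kern_self]
    simp only [tkern_self hd]
    exact le_of_tendsto' tendsto_log_succ fun m =>
      le_iSup (fun m : ℕ => ENNReal.ofReal (Real.log ((m : ℝ) + 1))) m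
  · have hr : 0 < ‖z - w‖ := norm_pos_iff.2 (sub_ne_zero.2 h)
    obtain ⟨m, hm⟩ := exists_nat_gt (d / ‖z - w‖)
    refine le_iSup_of_le m ?_
    simp only [kern, h, if_false, tkern]
    change ENNReal.ofReal _ ≤ ENNReal.ofReal _
    rw [max_eq_left]
    rw [div_le_iff₀ (by positivity)]
    rw [div_lt_iff₀ hr] at hm
    nlinarith

lemma continuous_tkern {d : ℝ} (hd : 0 < d) (m : ℕ) :
    Continuous fun p : ℂ × ℂ => tkern d m p.1 p.2 := by
  have h1 : 0 < d / ((m : ℝ) + 1) := by positivity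
  refine continuous_real_toNNReal.comp (Continuous.log ?_ fun p => ?_)
  · refine continuous_const.div (by fun_prop) fun p => (lt_max_of_lt_right h1).ne'
  · exact (div_pos hd (lt_max_of_lt_right h1)).ne'

lemma measurable_kern {d : ℝ} (hd : 0 < d) : Measurable fun p : ℂ × ℂ => kern d p.1 p.2 := by
  simp only [kern_eq_iSup hd]
  exact Measurable.iSup fun m => (continuous_tkern hd m).measurable.coe_nnreal_ennreal

lemma measurable_kern_right {d : ℝ} (hd : 0 < d) (z : ℂ) : Measurable (kern d z) :=
  (measurable_kern hd).comp measurable_prodMk_left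

lemma continuous_tkern_right {d : ℝ} (hd : 0 < d) (m : ℕ) (z : ℂ) : Continuous (tkern d m z) :=
  (continuous_tkern hd m).comp (by fun_prop : Continuous fun w : ℂ => (z, w))

lemma measurable_tkern_right {d : ℝ} (hd : 0 < d) (m : ℕ) (z : ℂ) :
    Measurable fun w => (tkern d m z w : ℝ≥0∞) :=
  (continuous_tkern_right hd m z).measurable.coe_nnreal_ennreal

/-- Moving the pole to a point which is at most twice as far away. -/
lemma kern_half_le {d : ℝ} (hd : 0 < d) {z z' w : ℂ} (h : ‖z' - w‖ ≤ 2 * ‖z - w‖) :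
    kern (d / 2) z w ≤ kern d z' w := by
  by_cases h' : z' = w
  · rw [h', kern_self]; exact le_top
  have hr' : 0 < ‖z' - w‖ := norm_pos_iff.2 (sub_ne_zero.2 h')
  have hr : 0 < ‖z - w‖ := by linarith
  have h'' : z ≠ w := sub_ne_zero.1 (norm_pos_iff.1 hr)
  simp only [kern, h', h'', if_false]
  apply ENNReal.ofReal_le_ofReal
  apply Real.log_le_log (by positivity)
  rw [div_div]
  gcongr

lemma kernEnergy_eq_prod {d : ℝ} (hd : 0 < d) (ρ : Measure ℂ) [SFinite ρ] :
    kernEnergy d ρ = ∫⁻ p, kern d p.1 p.2 ∂(ρ.prod ρ) :=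
  (lintegral_prod _ (measurable_kern hd).aemeasurable).symm

/-- The truncated potential of a measure. -/
noncomputable def tpot (d : ℝ) (m : ℕ) (σ : Measure ℂ) (z : ℂ) : ℝ := ∫ w, (tkern d m z w : ℝ) ∂σ

lemma integrable_tkern {d : ℝ} (hd : 0 < d) (m : ℕ) (σ : Measure ℂ) [IsFiniteMeasure σ] (z : ℂ) :
    Integrable (fun w => (tkern d m z w : ℝ)) σ := by
  refine Integrable.of_bound (C := Real.log (m + 1))
    ((NNReal.continuous_coe.comp (continuous_tkern_right hd m z)).aestronglyMeasurable) ?_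
  filter_upwards with w
  simpa using tkern_le hd m z w

lemma lintegral_tkern {d : ℝ} (hd : 0 < d) (m : ℕ) (σ : Measure ℂ) [IsFiniteMeasure σ] (z : ℂ) :
    ∫⁻ w, (tkern d m z w : ℝ≥0∞) ∂σ = ENNReal.ofReal (tpot d m σ z) := by
  rw [tpot, ofReal_integral_eq_lintegral_ofReal (integrable_tkern hd m σ z)
    (Eventually.of_forall fun w => NNReal.coe_nonneg _)]
  simp

lemma continuous_tpot {d : ℝ} (hd : 0 < d) (m : ℕ) (σ : Measure ℂ) [IsFiniteMeasure σ] :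
    Continuous (tpot d m σ) := by
  refine continuous_of_dominated (bound := fun _ => Real.log (m + 1)) (fun z => ?_) (fun z => ?_)
    (integrable_const _) ?_
  · exact (integrable_tkern hd m σ z).aestronglyMeasurable
  · filter_upwards with w
    simpa using tkern_le hd m z w
  · filter_upwards with w
    exact NNReal.continuous_coe.comp
      ((continuous_tkern hd m).comp (by fun_prop : Continuous fun z : ℂ => (z, w)))

lemma tpot_nonneg (d : ℝ) (m : ℕ) (σ : Measure ℂ) (z : ℂ) : 0 ≤ tpot d m σ z :=
  integral_nonneg fun _ => NNReal.coe_nonneg _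

lemma tpot_le {d : ℝ} (hd : 0 < d) (m : ℕ) (σ : Measure ℂ) [IsFiniteMeasure σ] (z : ℂ) :
    tpot d m σ z ≤ σ.real Set.univ * Real.log (m + 1) := by
  have := integral_mono (integrable_tkern hd m σ z) (integrable_const (Real.log (m + 1)))
    (fun w => tkern_le hd m z w)
  simpa [tpot] using this

lemma lintegral_kern_eq_iSup {d : ℝ} (hd : 0 < d) (σ : Measure ℂ) (z : ℂ) :
    ∫⁻ w, kern d z w ∂σ = ⨆ m, ∫⁻ w, (tkern d m z w : ℝ≥0∞) ∂σ := by
  simp only [kern_eq_iSup hd]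
  exact lintegral_iSup (fun m => measurable_tkern_right hd m z) fun m n h w =>
    ENNReal.coe_le_coe.2 (tkern_mono hd z w h)

/-- Logarithmic potentials are lower semicontinuous. -/
lemma isClosed_setOf_lintegral_kern_le {d : ℝ} (hd : 0 < d) (σ : Measure ℂ) [IsFiniteMeasure σ]
    (c : ℝ≥0∞) : IsClosed {z | ∫⁻ w, kern d z w ∂σ ≤ c} := by
  simp only [lintegral_kern_eq_iSup hd, iSup_le_iff, lintegral_tkern hd, Set.ofPred_forall]
  exact isClosed_iInter fun m => isClosed_le
    (ENNReal.continuous_ofReal.comp (continuous_tpot hd m σ)) continuous_const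

lemma measurable_lintegral_kern {d : ℝ} (hd : 0 < d) (σ : Measure ℂ) [SFinite σ] :
    Measurable fun z => ∫⁻ w, kern d z w ∂σ :=
  (measurable_kern hd).lintegral_prod_right'

/-! ### Energies, weak compactness and outer capacity. -/

/-- The Coulomb energy in terms of the nonnegative kernel. -/
lemma energy_eq_kernEnergy_sub {d : ℝ} (hd : 1 ≤ d) {B : Set ℂ}
    (hB : ∀ z ∈ B, ∀ w ∈ B, ‖z - w‖ ≤ d) {ρ : Measure ℂ} (hρ : IsProbabilityOn B ρ) :
    energy ρ = (kernEnergy d ρ : EReal) - (Real.log d : ℝ) := by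
  have := hρ.1
  have hd0 : 0 < d := by linarith
  have hl : 0 ≤ Real.log d := Real.log_nonneg hd
  -- Written with sums only, since subtraction in `ℝ≥0∞` truncates. The bound on the negative part
  -- keeps `q` below finite.
  have key : ∀ z ∈ B, ∀ w ∈ B,
      (logKernel z w).toENNReal + ENNReal.ofReal (Real.log d)
        = kern d z w + (-(logKernel z w)).toENNReal ∧
      (-(logKernel z w)).toENNReal ≤ ENNReal.ofReal (Real.log d) := by
    intro z hz w hw
    by_cases h : z = w
    · subst h; simp [kern_self, logKernel]
    have hr : 0 < ‖z - w‖ := norm_pos_iff.2 (sub_ne_zero.2 h)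
    have h1 : logKernel z w = ((-Real.log ‖z - w‖ : ℝ) : EReal) := by
      rw [logKernel, ENNReal.log_inv, edist_dist, dist_eq_norm, ENNReal.log_ofReal_of_pos hr]
      simp
    have h2 : Real.log ‖z - w‖ ≤ Real.log d := Real.log_le_log hr (hB z hz w hw)
    rw [h1, ← EReal.coe_neg, EReal.toENNReal_of_ne_top (EReal.coe_ne_top _),
      EReal.toENNReal_of_ne_top (EReal.coe_ne_top _)]
    simp only [EReal.toReal_coe, neg_neg, kern, h, if_false]
    rw [Real.log_div hd0.ne' hr.ne']
    refine ⟨?_, ENNReal.ofReal_le_ofReal h2⟩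
    rcases le_total 0 (Real.log ‖z - w‖) with h3 | h3
    · rw [ENNReal.ofReal_of_nonpos (by linarith : -Real.log ‖z - w‖ ≤ 0),
        ← ENNReal.ofReal_add (by linarith) h3]
      simp
    · rw [ENNReal.ofReal_of_nonpos h3, add_zero, ← ENNReal.ofReal_add (by linarith) hl]
      congr 1; ring
  have hae : ∀ᵐ p ∂(ρ.prod ρ), p.1 ∈ B ∧ p.2 ∈ B := by
    have hB' : ∀ᵐ z ∂ρ, z ∈ B := hρ.2
    exact (Measure.quasiMeasurePreserving_fst.ae hB').and
      (Measure.quasiMeasurePreserving_snd.ae hB')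
  set p := ∫⁻ x, (logKernel x.1 x.2).toENNReal ∂(ρ.prod ρ)
  set q := ∫⁻ x, (-logKernel x.1 x.2).toENNReal ∂(ρ.prod ρ)
  have hsum : p + ENNReal.ofReal (Real.log d) = kernEnergy d ρ + q := by
    rw [kernEnergy_eq_prod hd0, ← lintegral_add_left (measurable_kern hd0)]
    rw [← lintegral_congr_ae (hae.mono fun x hx => (key x.1 hx.1 x.2 hx.2).1),
      lintegral_add_right _ measurable_const]
    simp [p]
  have hq : q ≤ ENNReal.ofReal (Real.log d) := by
    calc q ≤ ∫⁻ x, ENNReal.ofReal (Real.log d) ∂(ρ.prod ρ) :=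
          lintegral_mono_ae (hae.mono fun x hx => (key x.1 hx.1 x.2 hx.2).2)
      _ = _ := by simp
  have hqt : q ≠ ⊤ := ne_top_of_le_ne_top ENNReal.ofReal_ne_top hq
  change ((p : ℝ≥0∞) : EReal) - (q : EReal) = _
  clear_value p q
  lift q to ℝ≥0 using hqt
  by_cases hp : p = ⊤
  · have : kernEnergy d ρ = ⊤ := by
      by_contra h
      rw [hp, top_add] at hsum
      exact ENNReal.add_ne_top.2 ⟨h, ENNReal.coe_ne_top⟩ hsum.symm
    rw [hp, this]
    simp only [EReal.coe_ennreal_top]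
    rw [EReal.top_sub_coe]
    exact EReal.top_sub_coe _
  · have hE : kernEnergy d ρ ≠ ⊤ := by
      intro h
      rw [h, top_add] at hsum
      exact ENNReal.add_ne_top.2 ⟨hp, ENNReal.ofReal_ne_top⟩ hsum
    lift p to ℝ≥0 using hp
    lift kernEnergy d ρ to ℝ≥0 using hE with e
    have h5 := congrArg ENNReal.toReal hsum
    rw [ENNReal.toReal_add (by simp) (by simp), ENNReal.toReal_add (by simp) (by simp),
      ENNReal.toReal_ofReal hl] at h5
    simp only [ENNReal.coe_toReal] at h5
    change (((p : ℝ) : EReal)) - (((q : ℝ) : EReal)) = ((e : ℝ) : EReal) - _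
    rw [← EReal.coe_sub, ← EReal.coe_sub]
    congr 1; linarith

/-- The truncated kernel as a bounded continuous function. -/
noncomputable def tkernBCF {d : ℝ} (hd : 0 < d) (m : ℕ) : ℂ × ℂ →ᵇ ℝ≥0 :=
  BoundedContinuousFunction.mkOfBound ⟨fun p => tkern d m p.1 p.2, continuous_tkern hd m⟩
    (Real.log (m + 1)) fun p q => by
      rw [NNReal.dist_eq, abs_le]
      have h1 := tkern_le hd m p.1 p.2
      have h2 := tkern_le hd m q.1 q.2
      have h3 := (tkern d m p.1 p.2).coe_nonneg
      have h4 := (tkern d m q.1 q.2).coe_nonneg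
      constructor <;> simp only [ContinuousMap.coe_mk] <;> linarith

lemma lintegral_tkern_prod {d : ℝ} (hd : 0 < d) (m : ℕ) (ν : Measure ℂ) [SFinite ν] :
    ∫⁻ z, ∫⁻ w, (tkern d m z w : ℝ≥0∞) ∂ν ∂ν = ∫⁻ p, (tkernBCF hd m p : ℝ≥0∞) ∂(ν.prod ν) :=
  (lintegral_prod _ (continuous_tkern hd m).measurable.coe_nnreal_ennreal.aemeasurable).symm

lemma continuous_lintegral_tkern {d : ℝ} (hd : 0 < d) (m : ℕ) :
    Continuous fun ν : ProbabilityMeasure ℂ =>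
      ∫⁻ z, ∫⁻ w, (tkern d m z w : ℝ≥0∞) ∂(ν : Measure ℂ) ∂(ν : Measure ℂ) := by
  simp only [lintegral_tkern_prod hd]
  refine continuous_iff_continuousAt.2 fun ν => ?_
  have h : Tendsto (fun ν' : ProbabilityMeasure ℂ => ν'.prod ν') (𝓝 ν) (𝓝 (ν.prod ν)) :=
    (ProbabilityMeasure.continuous_prod.comp
      (continuous_id.prodMk continuous_id)).tendsto ν
  exact ProbabilityMeasure.tendsto_iff_forall_lintegral_tendsto.1 h (tkernBCF hd m)

lemma kernEnergy_eq_iSup {d : ℝ} (hd : 0 < d) (ν : Measure ℂ) [SFinite ν] :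
    kernEnergy d ν = ⨆ m, ∫⁻ z, ∫⁻ w, (tkern d m z w : ℝ≥0∞) ∂ν ∂ν := by
  rw [kernEnergy_eq_prod hd]
  simp only [lintegral_tkern_prod hd, kern_eq_iSup hd]
  exact lintegral_iSup (fun m => (continuous_tkern hd m).measurable.coe_nnreal_ennreal)
    fun m n h p => ENNReal.coe_le_coe.2 (tkern_mono hd p.1 p.2 h)

lemma lintegral_lintegral_tkern_mono {d : ℝ} (hd : 0 < d) (ν : Measure ℂ) :
    Monotone fun m => ∫⁻ z, ∫⁻ w, (tkern d m z w : ℝ≥0∞) ∂ν ∂ν := fun _ _ h =>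
  lintegral_mono fun z => lintegral_mono fun w => ENNReal.coe_le_coe.2 (tkern_mono hd z w h)

/-- If all probability measures on a compact set have energy greater than `c`, the same holds
with a truncated energy for the probability measures on a neighbourhood of the set. -/
lemma exists_truncated_energy_gt {d : ℝ} (hd : 0 < d) {K : Set ℂ} (hK : IsCompact K) {c : ℝ≥0∞}
    (h : ∀ ρ, IsProbabilityOn K ρ → c < kernEnergy d ρ) :
    ∃ m : ℕ, ∀ ν, IsProbabilityOn (Metric.cthickening (1 / ((m : ℝ) + 1)) K) ν →
      c < ∫⁻ z, ∫⁻ w, (tkern d m z w : ℝ≥0∞) ∂ν ∂ν := by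
  by_contra! hcon
  set F : ℕ → Set ℂ := fun m => Metric.cthickening (1 / ((m : ℝ) + 1)) K with hF
  have hFm : Antitone F := fun m n hmn => by
    apply Metric.cthickening_mono
    have : (m : ℝ) ≤ n := by exact_mod_cast hmn
    gcongr
  let S : ℕ → Set (ProbabilityMeasure ℂ) := fun m =>
    {ν | (ν : Measure ℂ) (F m)ᶜ ≤ 0} ∩
      {ν | ∫⁻ z, ∫⁻ w, (tkern d m z w : ℝ≥0∞) ∂(ν : Measure ℂ) ∂(ν : Measure ℂ) ≤ c}
  have hc : ∀ m, IsCompact {ν : ProbabilityMeasure ℂ | (ν : Measure ℂ) (F m)ᶜ ≤ 0} := fun m => by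
    have := isCompact_setOfPred_probabilityMeasure_mass_eq_compl_isCompact_le (E := ℂ)
      (u := fun _ => 0) (K := fun _ => F m) tendsto_const_nhds (fun _ => hK.cthickening)
      (Or.inr monotone_const)
    convert this using 1
    ext ν
    simp
  have hS : ∀ m, IsClosed (S m) := fun m =>
    (hc m).isClosed.inter (isClosed_le (continuous_lintegral_tkern hd m) continuous_const)
  -- Cantor's intersection theorem for measures, the sets being compact by tightness. A measure in
  -- every `S m` lives on `⋂ m, F m = K`, and all its truncated energies are at most `c`; monotone
  -- convergence then contradicts `h`.
  obtain ⟨ν, hν⟩ := IsCompact.nonempty_iInter_of_sequence_nonempty_isCompact_isClosed S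
    (fun m => by
      rintro ν ⟨h1, h2⟩
      refine ⟨(measure_mono (Set.compl_subset_compl.2 (hFm m.le_succ))).trans h1, ?_⟩
      exact (lintegral_lintegral_tkern_mono hd _ m.le_succ).trans h2)
    (fun m => by
      obtain ⟨ν, hν, h1⟩ := hcon m
      exact ⟨⟨ν, hν.1⟩, hν.2.le, h1⟩)
    ((hc 0).inter_right
      (isClosed_le (continuous_lintegral_tkern hd 0) continuous_const)) hS
  rw [Set.mem_iInter] at hν
  have hcl : ⋂ m, F m = K := by
    apply subset_antisymm
    · rw [← hK.isClosed.closure_eq, Metric.closure_eq_iInter_cthickening]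
      refine Set.subset_iInter₂ fun ε hε => ?_
      obtain ⟨m, hm⟩ := exists_nat_one_div_lt hε
      exact (Set.iInter_subset _ m).trans (Metric.cthickening_mono hm.le K)
    · exact Set.subset_iInter fun m => Metric.self_subset_cthickening _
  have hνK : IsProbabilityOn K ν := by
    refine ⟨inferInstance, ?_⟩
    rw [← hcl, Set.compl_iInter]
    exact measure_iUnion_null fun m => le_antisymm (hν m).1 bot_le
  refine (h ν hνK).not_ge ?_
  rw [kernEnergy_eq_iSup hd]
  exact iSup_le fun m => (hν m).2

lemma IsProbabilityOn.mono {K L : Set ℂ} {ρ : Measure ℂ} (h : IsProbabilityOn K ρ) (hKL : K ⊆ L) :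
    IsProbabilityOn L ρ :=
  ⟨h.1, measure_mono_null (Set.compl_subset_compl.2 hKL) h.2⟩

lemma compactCapacity_le {d : ℝ} (hd : 1 ≤ d) {B K : Set ℂ}
    (hB : ∀ z ∈ B, ∀ w ∈ B, ‖z - w‖ ≤ d) (hKB : K ⊆ B) {e : ℝ}
    (h : ∀ ρ, IsProbabilityOn K ρ → ENNReal.ofReal e ≤ kernEnergy d ρ) :
    compactCapacity K ≤ ENNReal.ofReal (d * Real.exp (-e)) := by
  have hd0 : 0 < d := by linarith
  have h1 : ((e - Real.log d : ℝ) : EReal) ≤ ⨅ (ρ : Measure ℂ) (_ : IsProbabilityOn K ρ), energy ρ := by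
    refine le_iInf₂ fun ρ hρ => ?_
    rw [energy_eq_kernEnergy_sub hd hB (hρ.mono hKB), EReal.coe_sub]
    refine EReal.sub_le_sub ?_ le_rfl
    calc (e : EReal) ≤ ((ENNReal.ofReal e : ℝ≥0∞) : EReal) := by
          rw [EReal.coe_ennreal_ofReal]; exact_mod_cast le_max_left _ _
      _ ≤ _ := EReal.coe_ennreal_le_coe_ennreal_iff.2 (h ρ hρ)
  calc compactCapacity K ≤ EReal.exp (-((e - Real.log d : ℝ) : EReal)) :=
        EReal.exp_monotone (EReal.neg_le_neg_iff.2 h1)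
    _ = ENNReal.ofReal (d * Real.exp (-e)) := by
        rw [← EReal.coe_neg, EReal.exp_coe]
        congr 1
        rw [neg_sub, sub_eq_add_neg, Real.exp_add, Real.exp_log hd0]

lemma lintegral_lintegral_smul_restrict (f : ℂ → ℂ → ℝ≥0∞) (ρ : Measure ℂ)
    (c : ℝ≥0∞) (S : Set ℂ) :
    ∫⁻ z, ∫⁻ w, f z w ∂(c • ρ.restrict S) ∂(c • ρ.restrict S) =
      c * (∫⁻ z in S, c * ∫⁻ w in S, f z w ∂ρ ∂ρ) := by
  simp

/-- Restriction can only lower the energy because the kernel is nonnegative. -/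
lemma kernEnergy_smul_restrict_le {d : ℝ} (hd : 0 < d) (ρ : Measure ℂ) [SFinite ρ]
    (c : ℝ≥0∞) (S : Set ℂ) :
    kernEnergy d (c • ρ.restrict S) ≤ c ^ 2 * kernEnergy d ρ := by
  rw [kernEnergy, lintegral_lintegral_smul_restrict, kernEnergy,
    lintegral_const_mul _ (measurable_lintegral_kern hd _), ← mul_assoc, ← sq]
  gcongr <;> exact Measure.restrict_le_self

/-- The normalized restriction of a finite measure to a set of positive measure. -/
lemma isProbabilityOn_inv_smul_restrict {ρ : Measure ℂ} [IsFiniteMeasure ρ] {S : Set ℂ}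
    (hS : MeasurableSet S) (h0 : ρ S ≠ 0) : IsProbabilityOn S ((ρ S)⁻¹ • ρ.restrict S) := by
  refine ⟨⟨?_⟩, ?_⟩
  · simp [ENNReal.inv_mul_cancel h0 (measure_ne_top ρ S)]
  · simp [Measure.restrict_apply hS.compl]

/-- Inner regularity puts mass more than `t` on a compact subset of `U`. Normalizing the restriction
divides the energy by the square of that mass, whence `t ^ 2`. -/
lemma lt_kernEnergy_of_lt_measure {d : ℝ} (hd : 0 < d) {ρ : Measure ℂ} [IsFiniteMeasure ρ]
    {U : Set ℂ} (hU : IsOpen U) {t e : ℝ≥0∞} (ht : t < ρ U)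
    (h : ∀ K ⊆ U, IsCompact K → ∀ σ, IsProbabilityOn K σ → e ≤ kernEnergy d σ) :
    t ^ 2 * e ≤ kernEnergy d ρ := by
  obtain ⟨K, hKU, hK, htK⟩ := hU.measurableSet.exists_lt_isCompact ht
  have hK0 : ρ K ≠ 0 := (bot_le.trans_lt htK).ne'
  have h1 := (h K hKU hK _ (isProbabilityOn_inv_smul_restrict hK.measurableSet hK0)).trans
    (kernEnergy_smul_restrict_le hd ρ _ K)
  calc t ^ 2 * e ≤ (ρ K) ^ 2 * (((ρ K)⁻¹) ^ 2 * kernEnergy d ρ) := by gcongr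
    _ = kernEnergy d ρ := by
      rw [← mul_assoc, ← mul_pow, ENNReal.mul_inv_cancel hK0 (measure_ne_top ρ K), one_pow, one_mul]

/-- A countable union of uniformly bounded compact sets of capacity zero has (outer)
capacity zero. -/
lemma capacity_iUnion_eq_zero {R d : ℝ} (hd : 1 ≤ d) (hRd : 2 * (R + 1) ≤ d) {K : ℕ → Set ℂ}
    (hK : ∀ i, IsCompact (K i)) (hKR : ∀ i, K i ⊆ Metric.closedBall 0 R)
    (h : ∀ i ρ, IsProbabilityOn (K i) ρ → kernEnergy d ρ = ⊤) :
    capacity (⋃ i, K i) = 0 := by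
  have hd0 : 0 < d := by linarith
  set B : Set ℂ := Metric.closedBall 0 (R + 1) with hBdef
  have hB : ∀ z ∈ B, ∀ w ∈ B, ‖z - w‖ ≤ d := by
    intro z hz w hw
    rw [hBdef, mem_closedBall_zero_iff] at hz hw
    linarith [norm_sub_le z w]
  -- Mass thresholds with sum `1/2`.
  let t : ℕ → ℝ≥0∞ := fun i => 2⁻¹ ^ (i + 2)
  have ht0 : ∀ i, t i ≠ 0 := fun i => by simp [t]
  have htt : ∀ i, t i ≠ ⊤ := fun i => by simp [t]
  have hts : ∑' i, t i < 1 := by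
    simp only [t, pow_add, ENNReal.tsum_mul_right, ENNReal.tsum_geometric, ENNReal.one_sub_inv_two,
      inv_inv]
    rw [sq, ← mul_assoc, ENNReal.mul_inv_cancel (by simp) (by simp), one_mul]
    exact ENNReal.inv_lt_one.2 ENNReal.one_lt_two
  have key : ∀ e : ℝ, capacity (⋃ i, K i) ≤ ENNReal.ofReal (d * Real.exp (-e)) := by
    intro e
    -- The energy level `e / t i ^ 2` is chosen so that mass more than `t i` in `U i` costs energy
    -- at least `e`.
    have hU : ∀ i, ∃ U : Set ℂ, IsOpen U ∧ K i ⊆ U ∧ U ⊆ B ∧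
        ∀ L ⊆ U, IsCompact L → ∀ σ, IsProbabilityOn L σ →
          ((t i) ^ 2)⁻¹ * ENNReal.ofReal e ≤ kernEnergy d σ := by
      intro i
      have hfin : ((t i) ^ 2)⁻¹ * ENNReal.ofReal e < ⊤ :=
        ENNReal.mul_lt_top (ENNReal.inv_lt_top.2 (pos_iff_ne_zero.2 (pow_ne_zero 2 (ht0 i))))
          ENNReal.ofReal_lt_top
      obtain ⟨m, hm⟩ := exists_truncated_energy_gt hd0 (hK i) (c := ((t i) ^ 2)⁻¹ * ENNReal.ofReal e)
        fun ρ hρ => by rw [h i ρ hρ]; exact hfin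
      refine ⟨Metric.thickening (1 / ((m : ℝ) + 1)) (K i), Metric.isOpen_thickening,
        Metric.self_subset_thickening (by positivity) _, ?_, fun L hL _ σ hσ => ?_⟩
      · intro z hz
        obtain ⟨w, hw, hzw⟩ := Metric.mem_thickening_iff.1 hz
        have h1 := hKR i hw
        have h2 : 1 / ((m : ℝ) + 1) ≤ 1 := by
          rw [div_le_one (by positivity)]; linarith [(Nat.cast_nonneg m : (0 : ℝ) ≤ m)]
        rw [Metric.mem_closedBall] at h1 ⊢
        linarith [dist_triangle z w 0]
      · have hσ' := hσ.1
        refine (hm σ (hσ.mono (hL.trans (Metric.thickening_subset_cthickening _ _)))).le.trans ?_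
        exact lintegral_mono fun z => lintegral_mono fun w => tkern_le_kern hd0 m z w
    choose U hUo hKU hUB hUe using hU
    refine (iInf₂_le (⋃ i, U i) (isOpen_iUnion hUo)).trans
      ((iInf_le _ (Set.iUnion_mono hKU)).trans ?_)
    refine iSup₂_le fun L hL => iSup_le fun hLU => ?_
    refine compactCapacity_le hd hB (hLU.trans (Set.iUnion_subset hUB)) fun ρ hρ => ?_
    have := hρ.1
    -- Pigeonhole: the total mass `1` exceeds `∑ t i`.
    obtain ⟨i, hi⟩ : ∃ i, t i < ρ (U i) := by
      by_contra! hcon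
      have h1 : (1 : ℝ≥0∞) ≤ ρ (⋃ i, U i) := by
        have h2 : ρ (⋃ i, U i)ᶜ = 0 := measure_mono_null (Set.compl_subset_compl.2 hLU) hρ.2
        rw [(prob_compl_eq_zero_iff (isOpen_iUnion hUo).measurableSet).1 h2]
      exact (h1.trans ((measure_iUnion_le U).trans (ENNReal.tsum_le_tsum hcon))).not_gt hts
    have h1 := lt_kernEnergy_of_lt_measure hd0 (hUo i) hi (hUe i)
    rwa [← mul_assoc, ENNReal.mul_inv_cancel (pow_ne_zero 2 (ht0 i)) (ENNReal.pow_ne_top (htt i)),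
      one_mul] at h1
  have hlim : Tendsto (fun e : ℝ => ENNReal.ofReal (d * Real.exp (-e))) atTop (𝓝 0) := by
    have h1 : Tendsto (fun e : ℝ => d * Real.exp (-e)) atTop (𝓝 (d * 0)) :=
      tendsto_const_nhds.mul Real.tendsto_exp_neg_atTop_nhds_zero
    simpa using ENNReal.tendsto_ofReal h1
  exact le_antisymm (ge_of_tendsto' hlim key) bot_le

/-! ### Equilibrium measures and their potentials. -/

/-- An equilibrium measure minimizes the energy, and has finite energy. -/
lemma IsEquilibriumMeasure.kernEnergy_eq {d : ℝ} (hd : 1 ≤ d) {B K : Set ℂ} {ρ : Measure ℂ}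
    (hB : ∀ z ∈ B, ∀ w ∈ B, ‖z - w‖ ≤ d) (hKB : K ⊆ B) (h : IsEquilibriumMeasure K ρ) :
    kernEnergy d ρ ≠ ⊤ ∧
    compactCapacity K = ENNReal.ofReal (d * Real.exp (-(kernEnergy d ρ).toReal)) ∧
    ∀ σ, IsProbabilityOn K σ → kernEnergy d ρ ≤ kernEnergy d σ := by
  have hd0 : 0 < d := by linarith
  have h1 := h.energy_eq
  have h2 : energy ρ = ⨅ (σ : Measure ℂ) (_ : IsProbabilityOn K σ), energy σ := by
    rw [h1, ENNReal.log_inv, compactCapacity, EReal.log_exp, neg_neg]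
  have hE := energy_eq_kernEnergy_sub hd hB (h.isProbabilityOn.mono hKB)
  have hfin : kernEnergy d ρ ≠ ⊤ := by
    intro hcon
    rw [hcon, EReal.coe_ennreal_top, EReal.top_sub_coe] at hE
    rw [h1, ENNReal.log_eq_top_iff, ENNReal.inv_eq_top] at hE
    exact h.capacity_pos.ne' hE
  refine ⟨hfin, ?_, fun σ hσ => ?_⟩
  · have h3 : compactCapacity K = EReal.exp (-energy ρ) := by rw [h2, compactCapacity]
    rw [h3, hE]
    lift kernEnergy d ρ to ℝ≥0 using hfin with e
    change EReal.exp (-(((e : ℝ) : EReal) - _)) = _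
    rw [← EReal.coe_sub, ← EReal.coe_neg, EReal.exp_coe, ENNReal.coe_toReal]
    congr 1
    rw [neg_sub, sub_eq_add_neg, Real.exp_add, Real.exp_log hd0]
  · have h3 : energy ρ ≤ energy σ := by rw [h2]; exact iInf₂_le σ hσ
    rw [hE, energy_eq_kernEnergy_sub hd hB (hσ.mono hKB)] at h3
    by_contra! hcon
    refine h3.not_gt ?_
    exact EReal.sub_lt_sub_of_lt_of_le (EReal.coe_ennreal_lt_coe_ennreal_iff.2 hcon) le_rfl
      (EReal.coe_ne_bot _) (EReal.coe_ne_top _)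

lemma lintegral_kern_swap {d : ℝ} (hd : 0 < d) (ρ σ : Measure ℂ) [SFinite ρ] [SFinite σ] :
    ∫⁻ z, ∫⁻ w, kern d z w ∂ρ ∂σ = ∫⁻ z, ∫⁻ w, kern d z w ∂σ ∂ρ := by
  rw [lintegral_lintegral_swap (measurable_kern hd).aemeasurable]
  simp only [kern_comm d]

lemma kernEnergy_add_smul {d : ℝ} (hd : 0 < d) (ρ σ : Measure ℂ) [IsFiniteMeasure ρ]
    [IsFiniteMeasure σ] (a b : ℝ≥0∞) :
    kernEnergy d (a • ρ + b • σ) = a ^ 2 * kernEnergy d ρ +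
      2 * (a * b) * (∫⁻ z, ∫⁻ w, kern d z w ∂ρ ∂σ) + b ^ 2 * kernEnergy d σ := by
  have h1 := measurable_lintegral_kern hd ρ
  have h2 := measurable_lintegral_kern hd σ
  simp only [kernEnergy, lintegral_add_measure, lintegral_smul_measure, smul_eq_mul]
  rw [lintegral_add_left (h1.const_mul a), lintegral_add_left (h1.const_mul a),
    lintegral_const_mul _ h1, lintegral_const_mul _ h1, lintegral_const_mul _ h2,
    lintegral_const_mul _ h2, lintegral_kern_swap hd σ ρ]
  ring

/-- The first variation at `t = 0`: the right side minus `i` is `t (2 (m - i) + t (i - 2 m + s))`;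
divide by `t` and let `t → 0`. -/
lemma le_of_forall_quadratic {i m s : ℝ}
    (h : ∀ t : ℝ, 0 < t → t < 1 → i ≤ (1 - t) ^ 2 * i + 2 * ((1 - t) * t) * m + t ^ 2 * s) :
    i ≤ m := by
  have h1 : ∀ᶠ t : ℝ in 𝓝[>] 0, 2 * (i - m) ≤ t * (i - 2 * m + s) := by
    filter_upwards [Ioo_mem_nhdsGT (zero_lt_one' ℝ)] with t ht
    have h2 := h t ht.1 ht.2
    have h3 : t * (2 * (i - m)) ≤ t * (t * (i - 2 * m + s)) := by nlinarith
    exact le_of_mul_le_mul_left h3 ht.1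
  have h2 : Tendsto (fun t : ℝ => t * (i - 2 * m + s)) (𝓝[>] 0) (𝓝 0) := by
    have : Tendsto (fun t : ℝ => t * (i - 2 * m + s)) (𝓝 0) (𝓝 (0 * (i - 2 * m + s))) :=
      tendsto_id.mul_const _
    rw [zero_mul] at this
    exact this.mono_left nhdsWithin_le_nhds
  linarith [ge_of_tendsto h2 h1]

/-- A minimizer of the energy has mixed energy at least `I` with every competitor of
finite energy. -/
lemma kernEnergy_le_mixed {d : ℝ} (hd : 0 < d) {K : Set ℂ} {ρ σ : Measure ℂ}
    (hρ : IsProbabilityOn K ρ) (hI : kernEnergy d ρ ≠ ⊤)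
    (hmin : ∀ σ, IsProbabilityOn K σ → kernEnergy d ρ ≤ kernEnergy d σ)
    (hσ : IsProbabilityOn K σ) (hs : kernEnergy d σ ≠ ⊤) :
    kernEnergy d ρ ≤ ∫⁻ z, ∫⁻ w, kern d z w ∂ρ ∂σ := by
  have := hρ.1
  have := hσ.1
  by_cases hm : ∫⁻ z, ∫⁻ w, kern d z w ∂ρ ∂σ = ⊤
  · rw [hm]; exact le_top
  have h1 : ∀ t : ℝ, 0 < t → t < 1 → kernEnergy d ρ ≤ ENNReal.ofReal (1 - t) ^ 2 * kernEnergy d ρ +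
      2 * (ENNReal.ofReal (1 - t) * ENNReal.ofReal t) * (∫⁻ z, ∫⁻ w, kern d z w ∂ρ ∂σ) +
        ENNReal.ofReal t ^ 2 * kernEnergy d σ := by
    intro t h0 h1
    rw [← kernEnergy_add_smul hd]
    refine hmin _ ⟨⟨?_⟩, ?_⟩
    · simp only [Measure.coe_add, Measure.coe_smul, Pi.add_apply, Pi.smul_apply, measure_univ,
        smul_eq_mul, mul_one]
      rw [← ENNReal.ofReal_add (by linarith) h0.le]; simp
    · simp [hρ.2, hσ.2]
  generalize ∫⁻ z, ∫⁻ w, kern d z w ∂ρ ∂σ = m at *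
  generalize kernEnergy d σ = s at *
  generalize kernEnergy d ρ = i at *
  lift i to ℝ≥0 using hI
  lift m to ℝ≥0 using hm
  lift s to ℝ≥0 using hs
  rw [ENNReal.coe_le_coe, ← NNReal.coe_le_coe]
  refine le_of_forall_quadratic (s := s) fun t h0 ht => ?_
  have h2 := ENNReal.toReal_mono (by finiteness) (h1 t h0 ht)
  rw [ENNReal.toReal_add (by finiteness) (by finiteness),
    ENNReal.toReal_add (by finiteness) (by finiteness)] at h2
  simpa [ENNReal.toReal_ofReal h0.le, ENNReal.toReal_ofReal (sub_nonneg.2 ht.le)] using h2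

/-- The potential of a minimizer of the energy is constant almost everywhere. -/
lemma ae_lintegral_kern_eq {d : ℝ} (hd : 0 < d) {K : Set ℂ} {ρ : Measure ℂ}
    (hρ : IsProbabilityOn K ρ) (hI : kernEnergy d ρ ≠ ⊤)
    (hmin : ∀ σ, IsProbabilityOn K σ → kernEnergy d ρ ≤ kernEnergy d σ) :
    ∀ᵐ z ∂ρ, ∫⁻ w, kern d z w ∂ρ ≤ kernEnergy d ρ := by
  have := hρ.1
  -- If the potential were at most `c` on a set of positive measure, the normalized restriction of
  -- `ρ` to this set would be a competitor of finite energy with mixed energy at most `c`.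
  have h1 : ∀ c < kernEnergy d ρ, ∀ᵐ z ∂ρ, c < ∫⁻ w, kern d z w ∂ρ := by
    intro c hc
    set S : Set ℂ := {z | ∫⁻ w, kern d z w ∂ρ ≤ c} with hSdef
    have hS : MeasurableSet S := (isClosed_setOf_lintegral_kern_le hd ρ c).measurableSet
    by_contra hcon
    have hS0 : ρ S ≠ 0 := by
      intro h; apply hcon; rw [ae_iff]; simpa only [not_lt] using h
    set σ := (ρ S)⁻¹ • ρ.restrict S with hσdef
    have hσ := isProbabilityOn_inv_smul_restrict hS hS0
    have hσK : IsProbabilityOn K σ := ⟨hσ.1, by simp [σ,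
      le_antisymm ((Measure.restrict_le_self (s := S) (μ := ρ) Kᶜ).trans hρ.2.le) bot_le]⟩
    have h2 := kernEnergy_le_mixed hd hρ hI hmin hσK (ne_top_of_le_ne_top
      (by finiteness) (kernEnergy_smul_restrict_le hd ρ _ S))
    have h3 : ∫⁻ z, ∫⁻ w, kern d z w ∂ρ ∂σ ≤ c := by
      have := hσ.1
      calc ∫⁻ z, ∫⁻ w, kern d z w ∂ρ ∂σ ≤ ∫⁻ z, c ∂σ := by
            apply lintegral_mono_ae
            have : ∀ᵐ z ∂σ, z ∈ S := hσ.2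
            exact this
        _ = c := by simp [show σ Set.univ = 1 from measure_univ]
    exact (h2.trans h3).not_gt hc
  have h2 : ∀ᵐ z ∂ρ, kernEnergy d ρ ≤ ∫⁻ w, kern d z w ∂ρ := by
    rcases eq_or_ne (kernEnergy d ρ) 0 with h0 | h0
    · rw [h0]; exact Eventually.of_forall fun _ => bot_le
    obtain ⟨u, -, hu, hut⟩ := exists_seq_strictMono_tendsto' (bot_lt_iff_ne_bot.2 h0)
    have h3 := ae_all_iff.2 fun n => h1 (u n) (hu n).2
    filter_upwards [h3] with z hz
    exact le_of_tendsto' hut fun n => (hz n).le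
  -- The average of the potential with respect to `ρ` is the energy itself, so the lower bound is an
  -- equality almost everywhere.
  have h3 := ae_eq_of_ae_le_of_lintegral_le h2 (by simpa using hI)
    (measurable_lintegral_kern hd ρ).aemeasurable (by simp [kernEnergy])
  filter_upwards [h3] with z hz
  exact hz.ge

/-! ### The maximum principle on the real line. -/

/-- For `y` outside the open interval `(α, β)`, the distance to `y` is affine on `[α, β]` and `-log`
is convex. The bounds by `d` make both logarithms on the right nonnegative, so that the positive
part loses nothing there. -/
lemma kern_convex {d : ℝ} {α β y t : ℝ} (ht0 : 0 < t) (ht1 : t < 1) (hαβ : α ≤ β)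
    (hαd : |α - y| ≤ d) (hβd : |β - y| ≤ d) (hy : y ≤ α ∨ β ≤ y) :
    kern d (((1 - t) * α + t * β : ℝ) : ℂ) y ≤
      ENNReal.ofReal (1 - t) * kern d α y + ENNReal.ofReal t * kern d β y := by
  have ht1' : 0 < 1 - t := sub_pos.2 ht1
  by_cases h1 : α = y
  · rw [h1, kern_self, ENNReal.mul_top (by simpa using ht1)]; simp
  by_cases h2 : β = y
  · rw [h2, kern_self, ENNReal.mul_top (by simpa using ht0)]; simp
  have hα : 0 < |α - y| := abs_pos.2 (sub_ne_zero.2 h1)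
  have hβ : 0 < |β - y| := abs_pos.2 (sub_ne_zero.2 h2)
  have hx : |(1 - t) * α + t * β - y| = (1 - t) * |α - y| + t * |β - y| := by
    rcases hy with hy | hy
    · rw [abs_of_nonneg (sub_nonneg.2 hy), abs_of_nonneg (by linarith : 0 ≤ β - y), abs_of_nonneg]
      · ring
      · nlinarith
    · rw [abs_of_nonpos (by linarith : α - y ≤ 0), abs_of_nonpos (sub_nonpos.2 hy), abs_of_nonpos]
      · ring
      · nlinarith
  have hx0 : 0 < |(1 - t) * α + t * β - y| := by rw [hx]; positivity
  have hd : 0 < d := hα.trans_le hαd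
  have hnorm : ∀ a : ℝ, ‖(a : ℂ) - y‖ = |a - y| := fun a => by
    rw [← Complex.ofReal_sub, Complex.norm_real, Real.norm_eq_abs]
  have hne : ∀ a : ℝ, 0 < |a - y| → (a : ℂ) ≠ y := fun a ha h => by
    rw [Complex.ofReal_inj] at h; simp [h] at ha
  simp only [kern, hne _ hα, hne _ hβ, hne _ hx0, if_false, hnorm]
  have hlα : 0 ≤ Real.log (d / |α - y|) := Real.log_nonneg ((one_le_div hα).2 hαd)
  have hlβ : 0 ≤ Real.log (d / |β - y|) := Real.log_nonneg ((one_le_div hβ).2 hβd)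
  rw [← ENNReal.ofReal_mul ht1'.le, ← ENNReal.ofReal_mul ht0.le, ← ENNReal.ofReal_add
    (mul_nonneg ht1'.le hlα) (mul_nonneg ht0.le hlβ)]
  apply ENNReal.ofReal_le_ofReal
  have hc := strictConcaveOn_log_Ioi.concaveOn.2 (Set.mem_Ioi.2 hα) (Set.mem_Ioi.2 hβ)
    ht1'.le ht0.le (by ring)
  simp only [smul_eq_mul] at hc
  rw [← hx] at hc
  rw [Real.log_div hd.ne' hα.ne', Real.log_div hd.ne' hβ.ne', Real.log_div hd.ne' hx0.ne']
  nlinarith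

lemma kern_le_kern_of_abs_le {d : ℝ} {x a y : ℝ} (hd : 0 < d) (h : |a - y| ≤ |x - y|) :
    kern d (x : ℂ) y ≤ kern d a y := by
  by_cases h1 : a = y
  · rw [h1, kern_self]; exact le_top
  have ha : 0 < |a - y| := abs_pos.2 (sub_ne_zero.2 h1)
  have h2 : x ≠ y := sub_ne_zero.1 (abs_pos.1 (ha.trans_le h))
  simp only [kern, Complex.ofReal_inj, h1, h2, if_false, ← Complex.ofReal_sub, Complex.norm_real,
    Real.norm_eq_abs]
  have := ha.trans_le h
  gcongr

/-- The maximum principle for logarithmic potentials of measures on the real line. -/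
lemma lintegral_kern_le_of_mem_real {d : ℝ} (hd : 0 < d) {K : Set ℂ} (hK : IsCompact K)
    (hKR : K ⊆ Set.range ((↑) : ℝ → ℂ)) (hKd : ∀ z ∈ K, ∀ w ∈ K, ‖z - w‖ ≤ d) {ρ : Measure ℂ}
    (hρ : IsProbabilityOn K ρ) {c : ℝ≥0∞} (h : ∀ᵐ z ∂ρ, ∫⁻ w, kern d z w ∂ρ ≤ c) :
    ∀ z ∈ K, ∫⁻ w, kern d z w ∂ρ ≤ c := by
  have := hρ.1
  intro z hz
  obtain ⟨x, rfl⟩ := hKR hz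
  -- `F` is compact by lower semicontinuity and carries `ρ`. A point of `K` outside `F` lies in a
  -- gap of `F`, where convexity compares it with the two ends, or beyond all of `F`, where the
  -- nearest point of `F` has the larger potential.
  set F : Set ℂ := K ∩ {z | ∫⁻ w, kern d z w ∂ρ ≤ c} with hFdef
  have hF : IsCompact F := hK.inter_right (isClosed_setOf_lintegral_kern_le hd ρ c)
  have hFae : ∀ᵐ w ∂ρ, w ∈ F := by
    have : ∀ᵐ w ∂ρ, w ∈ K := hρ.2
    filter_upwards [this, h] with w h1 h2 using ⟨h1, h2⟩
  by_cases hxF : (x : ℂ) ∈ F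
  · exact hxF.2
  set G : Set ℝ := ((↑) : ℝ → ℂ) ⁻¹' F with hGdef
  have hG : IsCompact G := Complex.isometry_ofReal.isClosedEmbedding.isCompact_preimage hF
  have hnorm : ∀ a b : ℝ, (a : ℂ) ∈ K → (b : ℂ) ∈ K → |a - b| ≤ d := fun a b ha hb => by
    have := hKd _ ha _ hb
    rwa [← Complex.ofReal_sub, Complex.norm_real, Real.norm_eq_abs] at this
  have hmono : ∀ a ∈ G, (∀ y ∈ G, |a - y| ≤ |x - y|) → ∫⁻ w, kern d x w ∂ρ ≤ c := by
    intro a ha hay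
    refine le_trans (lintegral_mono_ae ?_) ha.2
    filter_upwards [hFae] with w hw
    obtain ⟨y, rfl⟩ := hKR hw.1
    exact kern_le_kern_of_abs_le hd (hay y hw)
  have hl : (G ∩ Set.Iic x).Nonempty → ∃ α ∈ G, α < x ∧ ∀ y ∈ G, y ≤ x → y ≤ α := by
    intro hne
    obtain ⟨α, hα, hα'⟩ := (hG.inter_right isClosed_Iic).exists_isGreatest hne
    refine ⟨α, hα.1, lt_of_le_of_ne hα.2 ?_, fun y hy hyx => hα' ⟨hy, hyx⟩⟩
    rintro rfl; exact hxF hα.1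
  have hr : (G ∩ Set.Ici x).Nonempty → ∃ β ∈ G, x < β ∧ ∀ y ∈ G, x ≤ y → β ≤ y := by
    intro hne
    obtain ⟨β, hβ, hβ'⟩ := (hG.inter_right isClosed_Ici).exists_isLeast hne
    refine ⟨β, hβ.1, lt_of_le_of_ne hβ.2 ?_, fun y hy hyx => hβ' ⟨hy, hyx⟩⟩
    rintro rfl; exact hxF hβ.1
  by_cases h1 : (G ∩ Set.Iic x).Nonempty
  · obtain ⟨α, hα, hαx, hα'⟩ := hl h1
    by_cases h2 : (G ∩ Set.Ici x).Nonempty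
    · obtain ⟨β, hβ, hxβ, hβ'⟩ := hr h2
      have hαβ : 0 < β - α := by linarith
      -- Here `(α, β)` is the gap of `F` that contains `x`.
      set t := (x - α) / (β - α) with ht
      have ht0 : 0 < t := div_pos (by linarith) hαβ
      have ht1 : t < 1 := (div_lt_one hαβ).2 (by linarith)
      have hx : x = (1 - t) * α + t * β := by
        have : t * (β - α) = x - α := div_mul_cancel₀ _ hαβ.ne'
        linarith
      calc ∫⁻ w, kern d x w ∂ρ ≤
            ∫⁻ w, ENNReal.ofReal (1 - t) * kern d α w + ENNReal.ofReal t * kern d β w ∂ρ := by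
            apply lintegral_mono_ae
            filter_upwards [hFae] with w hw
            obtain ⟨y, rfl⟩ := hKR hw.1
            rw [hx]
            refine kern_convex ht0 ht1 (by linarith) (hnorm _ _ hα.1 hw.1) (hnorm _ _ hβ.1 hw.1) ?_
            rcases le_total y x with hyx | hyx
            · exact Or.inl (hα' y hw hyx)
            · exact Or.inr (hβ' y hw hyx)
        _ = ENNReal.ofReal (1 - t) * (∫⁻ w, kern d α w ∂ρ) +
              ENNReal.ofReal t * ∫⁻ w, kern d β w ∂ρ := by
            rw [lintegral_add_left ((measurable_kern_right hd α).const_mul _),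
              lintegral_const_mul _ (measurable_kern_right hd _),
              lintegral_const_mul _ (measurable_kern_right hd _)]
        _ ≤ ENNReal.ofReal (1 - t) * c + ENNReal.ofReal t * c := by
            gcongr
            · exact hα.2
            · exact hβ.2
        _ = c := by
            rw [← add_mul, ← ENNReal.ofReal_add (by linarith) ht0.le]; simp
    -- All of `F` lies to the left of `x`.
    · refine hmono α hα fun y hy => ?_
      have hyx : y ≤ x := by
        by_contra! hxy; exact h2 ⟨y, hy, hxy.le⟩
      have := hα' y hy hyx
      rw [abs_of_nonneg (by linarith), abs_of_nonneg (by linarith)]; linarith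
  · have h2 : (G ∩ Set.Ici x).Nonempty := by
      obtain ⟨w, hw⟩ := hFae.exists
      obtain ⟨y, rfl⟩ := hKR hw.1
      rcases le_total y x with hyx | hyx
      · exact absurd ⟨y, hw, hyx⟩ h1
      · exact ⟨y, hw, hyx⟩
    obtain ⟨β, hβ, hxβ, hβ'⟩ := hr h2
    refine hmono β hβ fun y hy => ?_
    have hyx : x ≤ y := by
      by_contra! hxy; exact h1 ⟨y, hy, hxy.le⟩
    have := hβ' y hy hyx
    rw [abs_of_nonpos (by linarith), abs_of_nonpos (by linarith)]; linarith

end PotentialTheory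

namespace OrthogonalPolynomials

/-! ### Orthogonal polynomials: extremality, Jacobi parameters, zeros. -/

variable {μ : Measure ℝ}

lemma integrable_of_continuous [IsFiniteMeasure μ] (hE : IsCompact μ.support) {f : ℝ → ℝ} (hf : Continuous f) :
    Integrable f μ := by
  have h := hf.continuousOn.integrableOn_compact (μ := μ) hE
  have hae : ∀ᵐ x ∂μ, x ∈ μ.support := Measure.support_mem_ae
  rwa [IntegrableOn, Measure.restrict_eq_self_of_ae_mem hae] at h

lemma integrable_eval_mul [IsFiniteMeasure μ] (hE : IsCompact μ.support) (P Q : ℝ[X]) :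
    Integrable (fun x => P.eval x * Q.eval x) μ :=
  integrable_of_continuous hE (P.continuous.mul Q.continuous)

lemma integral_add_eval_mul [IsFiniteMeasure μ] (hE : IsCompact μ.support) (P Q S : ℝ[X]) :
    ∫ x, P.eval x * (Q + S).eval x ∂μ =
      ∫ x, P.eval x * Q.eval x ∂μ + ∫ x, P.eval x * S.eval x ∂μ := by
  rw [← integral_add (integrable_eval_mul hE P Q) (integrable_eval_mul hE P S)]
  simp [mul_add]

lemma integral_C_mul_eval_mul (c : ℝ) (P Q : ℝ[X]) :
    ∫ x, P.eval x * (C c * Q).eval x ∂μ = c * ∫ x, P.eval x * Q.eval x ∂μ := by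
  rw [← integral_const_mul]
  congr 1; ext x; simp; ring

lemma monicOP_monic_natDegree (μ : Measure ℝ) (n : ℕ) :
    (monicOP μ n).Monic ∧ (monicOP μ n).natDegree = n := by
  induction n using Nat.strong_induction_on with
  | _ n ih =>
    rw [monicOP]
    have hdeg : (∑ k : Fin n, C ((∫ x, x ^ n * (monicOP μ k).eval x ∂μ) /
        (∫ x, (monicOP μ k).eval x ^ 2 ∂μ)) * monicOP μ k).degree < n := by
      rw [← mem_degreeLT]
      refine Submodule.sum_mem _ fun k _ => ?_
      rw [← smul_eq_C_mul]
      refine Submodule.smul_mem _ _ (mem_degreeLT.2 ?_)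
      refine degree_le_natDegree.trans_lt ?_
      rw [(ih k k.2).2]
      exact_mod_cast k.2
    constructor
    · rw [sub_eq_add_neg]
      exact monic_X_pow_add (by rwa [degree_neg])
    · have : (X ^ n - ∑ k : Fin n, C ((∫ x, x ^ n * (monicOP μ k).eval x ∂μ) /
        (∫ x, (monicOP μ k).eval x ^ 2 ∂μ)) * monicOP μ k).degree = (n : WithBot ℕ) := by
        rw [degree_sub_eq_left_of_degree_lt (by rwa [degree_X_pow]), degree_X_pow]
      exact natDegree_eq_of_degree_eq_some this

lemma degree_monicOP (μ : Measure ℝ) (n : ℕ) : (monicOP μ n).degree = n := by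
  rw [degree_eq_natDegree (monicOP_monic_natDegree μ n).1.ne_zero, (monicOP_monic_natDegree μ n).2]

/-- No nonzero polynomial vanishes in `L²(μ)`. -/
def IsNondegenerate (μ : Measure ℝ) : Prop := ∀ Q : ℝ[X], Q ≠ 0 → 0 < ∫ x, Q.eval x * Q.eval x ∂μ

lemma integral_monicOP_mul_monicOP [IsFiniteMeasure μ] (hE : IsCompact μ.support) (hμ : IsNondegenerate μ) (n : ℕ) :
    ∀ k < n, ∫ x, (monicOP μ n).eval x * (monicOP μ k).eval x ∂μ = 0 := by
  induction n using Nat.strong_induction_on with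
  | _ n ih =>
    intro j hj
    have hk : ∀ k : Fin n, k ≠ ⟨j, hj⟩ →
        ∫ x, (monicOP μ j).eval x * (monicOP μ k).eval x ∂μ = 0 := by
      intro k hkj
      have hkj' : (k : ℕ) ≠ j := fun h => hkj (Fin.ext h)
      rcases lt_or_gt_of_ne hkj' with h | h
      · exact ih j hj k h
      · rw [← ih k k.2 j h]; simp only [mul_comm]
    have hsum : ∀ x, (monicOP μ n).eval x * (monicOP μ j).eval x =
        x ^ n * (monicOP μ j).eval x - ∑ k : Fin n, ((∫ x, x ^ n * (monicOP μ k).eval x ∂μ) /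
          (∫ x, (monicOP μ k).eval x ^ 2 ∂μ)) *
            ((monicOP μ j).eval x * (monicOP μ k).eval x) := by
      intro x
      conv_lhs => rw [monicOP]
      simp only [eval_sub, eval_pow, eval_X, eval_finsetSum, eval_mul, eval_C, sub_mul,
        Finset.sum_mul]
      congr 1
      exact Finset.sum_congr rfl fun k _ => by ring
    simp only [hsum]
    rw [integral_sub, integral_finsetSum]
    · simp only [integral_const_mul]
      rw [Finset.sum_eq_single ⟨j, hj⟩]
      · have h0 := hμ _ (monicOP_monic_natDegree μ j).1.ne_zero
        simp only [← sq] at h0 ⊢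
        rw [div_mul_cancel₀ _ h0.ne', sub_self]
      · intro k _ hkj
        rw [hk k hkj, mul_zero]
      · simp
    · exact fun k _ => (integrable_eval_mul hE _ _).const_mul _
    · exact integrable_of_continuous hE ((continuous_pow n).mul (monicOP μ j).continuous)
    · exact integrable_finsetSum _ fun k _ => (integrable_eval_mul hE _ _).const_mul _

lemma integral_monicOP_mul_eq_zero [IsFiniteMeasure μ] (hE : IsCompact μ.support) (hμ : IsNondegenerate μ) {n : ℕ}
    {Q : ℝ[X]} (hQ : Q.degree < n) : ∫ x, (monicOP μ n).eval x * Q.eval x ∂μ = 0 := by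
  have key : ∀ m ≤ n, ∀ Q : ℝ[X], Q.degree < m →
      ∫ x, (monicOP μ n).eval x * Q.eval x ∂μ = 0 := by
    intro m
    induction m with
    | zero =>
      intro _ Q hQ
      have : Q = 0 := by
        rw [← degree_eq_bot]
        exact Nat.WithBot.lt_zero_iff.1 (by simpa using hQ)
      simp [this]
    | succ m ih =>
      intro hm Q hQ
      have hQ' : Q.degree ≤ m := by
        rw [← natDegree_le_iff_degree_le]
        by_cases h0 : Q = 0
        · simp [h0]
        · exact Nat.lt_succ_iff.1 ((natDegree_lt_iff_degree_lt h0).2 hQ)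
      -- Subtracting the multiple of `monicOP μ m` with the same coefficient of `X ^ m` lowers the
      -- degree.
      have hdeg : (Q - C (Q.coeff m) * monicOP μ m).degree < m := by
        rw [degree_lt_iff_coeff_zero]
        intro k hk
        have h1 := monicOP_monic_natDegree μ m
        rcases hk.eq_or_lt with rfl | hk
        · have h2 := h1.1.coeff_natDegree
          rw [h1.2] at h2
          simp [h2]
        · rw [coeff_sub, coeff_C_mul, coeff_eq_zero_of_degree_lt (hQ'.trans_lt (by exact_mod_cast hk)),
            coeff_eq_zero_of_natDegree_lt (p := monicOP μ m) (by rw [h1.2]; exact hk)]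
          simp
      have h1 := integral_add_eval_mul hE (monicOP μ n) (C (Q.coeff m) * monicOP μ m)
        (Q - C (Q.coeff m) * monicOP μ m)
      rw [add_sub_cancel, integral_C_mul_eval_mul, ih (by omega) _ hdeg,
        integral_monicOP_mul_monicOP hE hμ n m (by omega)] at h1
      simpa using h1
  exact key n le_rfl Q hQ

lemma degree_sub_monicOP_lt {n : ℕ} {Q : ℝ[X]} (hQ : Q.Monic) (hn : Q.natDegree = n) :
    (Q - monicOP μ n).degree < n := by
  have h := monicOP_monic_natDegree μ n
  have h1 : Q.degree = n := by rw [degree_eq_natDegree hQ.ne_zero, hn]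
  rw [← h1]
  exact degree_sub_lt_left (by rw [h1, degree_monicOP]) hQ.ne_zero (by rw [hQ.leadingCoeff, h.1.leadingCoeff])

/-- `Q - P_n` has lower degree, hence is orthogonal to `P_n`. This yields both the extremal property
and, with `Q = X P_k`, the formula for the Jacobi parameters. -/
lemma integral_monicOP_mul_monic [IsFiniteMeasure μ] (hE : IsCompact μ.support) (hμ : IsNondegenerate μ) {n : ℕ}
    {Q : ℝ[X]} (hQ : Q.Monic) (hn : Q.natDegree = n) :
    ∫ x, (monicOP μ n).eval x * Q.eval x ∂μ =
      ∫ x, (monicOP μ n).eval x * (monicOP μ n).eval x ∂μ := by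
  have h1 := integral_add_eval_mul hE (monicOP μ n) (monicOP μ n) (Q - monicOP μ n)
  rw [add_sub_cancel, integral_monicOP_mul_eq_zero hE hμ (degree_sub_monicOP_lt hQ hn),
    add_zero] at h1
  exact h1

/-- The monic orthogonal polynomials have the least `L²` norm among the monic polynomials. -/
lemma integral_monicOP_sq_le [IsFiniteMeasure μ] (hE : IsCompact μ.support) (hμ : IsNondegenerate μ) {n : ℕ}
    {Q : ℝ[X]} (hQ : Q.Monic) (hn : Q.natDegree = n) :
    ∫ x, (monicOP μ n).eval x * (monicOP μ n).eval x ∂μ ≤ ∫ x, Q.eval x * Q.eval x ∂μ := by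
  have h1 := integral_monicOP_mul_monic hE hμ hQ hn
  -- Pythagoras: `‖Q‖² = ‖P_n‖² + ‖Q - P_n‖²`.
  have h2 : 0 ≤ ∫ x, (Q - monicOP μ n).eval x * (Q - monicOP μ n).eval x ∂μ :=
    integral_nonneg fun x => mul_self_nonneg _
  have hcomm : ∀ A B : ℝ[X], ∫ x, A.eval x * B.eval x ∂μ = ∫ x, B.eval x * A.eval x ∂μ :=
    fun A B => by simp only [mul_comm]
  have h3 := integral_add_eval_mul hE Q (monicOP μ n) (Q - monicOP μ n)
  have h4 := integral_add_eval_mul hE (Q - monicOP μ n) (monicOP μ n) (Q - monicOP μ n)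
  have h5 := integral_monicOP_mul_eq_zero hE hμ (degree_sub_monicOP_lt (μ := μ) hQ hn)
  rw [add_sub_cancel] at h3 h4
  rw [hcomm] at h5
  have h6 := hcomm Q (monicOP μ n)
  have h7 := hcomm Q (Q - monicOP μ n)
  linarith

/-- The `L²(μ)` norm of the `n`-th monic orthogonal polynomial. -/
noncomputable def normOP (μ : Measure ℝ) (n : ℕ) : ℝ :=
  Real.sqrt (∫ x, (monicOP μ n).eval x ^ 2 ∂μ)

lemma normOP_sq (μ : Measure ℝ) (n : ℕ) :
    normOP μ n ^ 2 = ∫ x, (monicOP μ n).eval x * (monicOP μ n).eval x ∂μ := by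
  rw [normOP, Real.sq_sqrt (integral_nonneg fun x => sq_nonneg _)]
  simp only [sq]

lemma normOP_pos (hμ : IsNondegenerate μ) (n : ℕ) : 0 < normOP μ n := by
  have := hμ _ (monicOP_monic_natDegree μ n).1.ne_zero
  rw [← normOP_sq] at this
  exact lt_of_le_of_ne (Real.sqrt_nonneg _) fun h => by simp [← h] at this

lemma jacobiA_eq_div [IsFiniteMeasure μ] (hE : IsCompact μ.support) (hμ : IsNondegenerate μ) (k : ℕ) :
    jacobiA μ k = normOP μ (k + 1) / normOP μ k := by
  have h := monicOP_monic_natDegree μ k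
  have hX : (X * monicOP μ k).Monic := monic_X.mul h.1
  have hXd : (X * monicOP μ k).natDegree = k + 1 := by
    rw [natDegree_X_mul h.1.ne_zero, h.2]
  have h1 := integral_monicOP_mul_monic hE hμ hX hXd
  rw [← normOP_sq] at h1
  have h2 : jacobiA μ k = ((normOP μ (k + 1))⁻¹ * (normOP μ k)⁻¹) *
      ∫ x, (monicOP μ (k + 1)).eval x * (X * monicOP μ k).eval x ∂μ := by
    rw [jacobiA, ← integral_const_mul]
    congr 1; ext x
    simp only [orthonormalOP, normOP, eval_mul, eval_C, eval_X]
    ring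
  rw [h2, h1]
  have := normOP_pos hμ (k + 1)
  have := normOP_pos hμ k
  field_simp

/-- The product of the quotients `‖P_{k+1}‖/‖P_k‖` telescopes. -/
lemma jacobiMean_eq [IsFiniteMeasure μ] (hE : IsCompact μ.support) (hμ : IsNondegenerate μ) (n : ℕ) :
    jacobiMean μ n = (normOP μ n / normOP μ 0) ^ ((1 : ℝ) / n) := by
  rw [jacobiMean]
  congr 1
  simp only [jacobiA_eq_div hE hμ]
  induction n with
  | zero => simp [(normOP_pos hμ 0).ne']
  | succ n ih =>
    rw [Finset.prod_range_succ, ih, div_mul_div_comm, mul_comm (normOP μ n),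
      mul_div_mul_right _ _ (normOP_pos hμ n).ne']

/-- The zeros of the orthogonal polynomials are real and lie in every interval that contains the
support of the measure. -/
lemma root_monicOP [IsFiniteMeasure μ] (hE : IsCompact μ.support) (hμ : IsNondegenerate μ) {R : ℝ}
    (hR : ∀ x ∈ μ.support, |x| ≤ R) {n : ℕ} {z : ℂ}
    (hz : z ∈ ((monicOP μ n).map (algebraMap ℝ ℂ)).roots) : ∃ a : ℝ, (a : ℂ) = z ∧ |a| ≤ R := by
  have hm := monicOP_monic_natDegree μ n
  have hdeg : ∀ D S : ℝ[X], monicOP μ n = D * S → 0 < D.natDegree → S.degree < n := by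
    intro D S h hD
    have h0 : D * S ≠ 0 := h ▸ hm.1.ne_zero
    have h1 := natDegree_mul (left_ne_zero_of_mul h0) (right_ne_zero_of_mul h0)
    rw [← h, hm.2] at h1
    rw [degree_eq_natDegree (right_ne_zero_of_mul h0)]
    exact_mod_cast (by omega : S.natDegree < n)
  -- If `P_n = D S` with `D ≥ c > 0` on the support, then `∫ P_n S = ∫ D S² > 0`, although `S` has
  -- degree less than `n`.
  have key : ∀ (D S : ℝ[X]) (c : ℝ), 0 < c → monicOP μ n = D * S → 0 < D.natDegree →
      ¬ (∀ x ∈ μ.support, c ≤ D.eval x) := by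
    intro D S c hc h hD hx
    have h0 : S ≠ 0 := by
      rintro rfl; rw [mul_zero] at h; exact hm.1.ne_zero h
    have h1 := integral_monicOP_mul_eq_zero hE hμ (hdeg D S h hD)
    have h2 : ∫ x, c * (S.eval x * S.eval x) ∂μ ≤
        ∫ x, (monicOP μ n).eval x * S.eval x ∂μ := by
      refine integral_mono_ae ((integrable_eval_mul hE S S).const_mul c)
        (integrable_eval_mul hE _ S) ?_
      filter_upwards [Measure.support_mem_ae] with x hxs
      simp only [h, eval_mul, mul_assoc]
      exact mul_le_mul_of_nonneg_right (hx x hxs) (mul_self_nonneg _)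
    rw [h1, integral_const_mul] at h2
    exact h2.not_gt (mul_pos hc (hμ S h0))
  have hroot : aeval z (monicOP μ n) = 0 := by
    rw [mem_roots (hm.1.map _).ne_zero, IsRoot, eval_map_algebraMap] at hz
    exact hz
  by_cases him : z.im = 0
  · have hza : ((z.re : ℝ) : ℂ) = z := Complex.ext (by simp) (by simp [him])
    refine ⟨z.re, hza, ?_⟩
    have hr : (monicOP μ n).IsRoot z.re := by
      rw [← hza] at hroot
      have : aeval ((algebraMap ℝ ℂ) z.re) (monicOP μ n) = 0 := hroot
      rw [aeval_algebraMap_apply] at this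
      simpa using this
    obtain ⟨S, hS⟩ := dvd_iff_isRoot.2 hr
    by_contra! hcon
    rcases lt_abs.1 hcon with h | h
    · refine key (C z.re - X) (-S) (z.re - R) (by linarith) (by rw [hS]; ring) ?_ fun x hx => ?_
      · rw [← neg_sub X, natDegree_neg, natDegree_X_sub_C]; exact one_pos
      · have := (abs_le.1 (hR x hx)).2
        simp; linarith
    · refine key (X - C z.re) S (-z.re - R) (by linarith) hS ?_ fun x hx => ?_
      · rw [natDegree_X_sub_C]; exact one_pos
      · have := (abs_le.1 (hR x hx)).1
        simp; linarith
  · exfalso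
    -- A pair of conjugate zeros gives the factor `(x - Re z)² + (Im z)²`, which is bounded below by
    -- `(Im z)²`.
    obtain ⟨S, hS⟩ := quadratic_dvd_of_aeval_eq_zero_im_ne_zero _ hroot him
    refine key _ S (z.im ^ 2) (by positivity) hS ?_ fun x _ => ?_
    · have : (X ^ 2 - C (2 * z.re) * X + C (‖z‖ ^ 2)).natDegree = 2 := by compute_degree!
      rw [this]; norm_num
    · have : ‖z‖ ^ 2 = z.re ^ 2 + z.im ^ 2 := by
        rw [Complex.sq_norm, Complex.normSq_apply]; ring
      simp [this]
      nlinarith [sq_nonneg (x - z.re)]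

/-! ### Fekete points and the upper bound for the norms. -/

open PotentialTheory
open scoped NNReal

/-- Needed in order to have arbitrarily many distinct Fekete points. On a finite support the
polynomial with these zeros would vanish in `L²(μ)`. -/
lemma IsNondegenerate.infinite_support {μ : Measure ℝ} (hμ : IsNondegenerate μ) :
    μ.support.Infinite := by
  intro hfin
  have h := hμ (∏ a ∈ hfin.toFinset, (X - C a))
    (monic_prod_of_monic _ _ fun a _ => monic_X_sub_C a).ne_zero
  rw [integral_eq_zero_of_ae] at h
  · exact h.false
  have hae : ∀ᵐ x ∂μ, x ∈ μ.support := Measure.support_mem_ae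
  filter_upwards [hae] with x hx
  have : (∏ a ∈ hfin.toFinset, (X - C a)).eval x = 0 := by
    rw [eval_prod]
    exact Finset.prod_eq_zero (hfin.mem_toFinset.2 hx) (by simp)
  simp [this]

/-- Fekete points of an infinite compact set: the polynomial that vanishes at all of the points
but one attains its maximum modulus at the remaining one. -/
lemma exists_fekete_points {E : Set ℝ} (hE : IsCompact E) (hinf : E.Infinite) (n : ℕ) :
    ∃ x : Fin (n + 1) → ℝ, (∀ i, x i ∈ E) ∧ Function.Injective x ∧
      ∀ i, ∀ y ∈ E, ∏ j ∈ Finset.univ.erase i, |y - x j| ≤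
        ∏ j ∈ Finset.univ.erase i, |x i - x j| := by
  -- The value `1` on the diagonal makes the full double product the square of the product over
  -- pairs.
  set g : (Fin (n + 1) → ℝ) → Fin (n + 1) → Fin (n + 1) → ℝ :=
    fun x a b => if a = b then 1 else |x a - x b| with hg
  have hg0 : ∀ x a b, 0 ≤ g x a b := fun x a b => by
    simp only [hg]; split_ifs <;> positivity
  have hcont : Continuous fun x : Fin (n + 1) → ℝ => ∏ a, ∏ b, g x a b := by
    refine continuous_finsetProd _ fun a _ => continuous_finsetProd _ fun b _ => ?_
    simp only [hg]
    split_ifs <;> fun_prop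
  obtain ⟨f⟩ : Nonempty (Fin (n + 1) ↪ E) := by
    have := hinf.to_subtype
    exact ⟨Fin.valEmbedding.trans (Infinite.natEmbedding E)⟩
  obtain ⟨x, hx, hmax⟩ := (isCompact_univ_pi fun _ : Fin (n + 1) => hE).exists_isMaxOn
    ⟨fun i => (f i : ℝ), fun i _ => (f i).2⟩ hcont.continuousOn
  have hxE : ∀ i, x i ∈ E := fun i => hx i (Set.mem_univ i)
  have hpos : 0 < ∏ a, ∏ b, g x a b := by
    refine lt_of_lt_of_le ?_ (hmax (fun i _ => (f i).2 :
      (fun i => (f i : ℝ)) ∈ Set.pi Set.univ fun _ => E))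
    refine Finset.prod_pos fun a _ => Finset.prod_pos fun b _ => ?_
    simp only [hg]
    split_ifs with hab
    · exact one_pos
    · exact abs_pos.2 (sub_ne_zero.2 fun h => hab (f.injective (Subtype.ext h)))
  -- Isolates the dependence on `x i`: each of its distances occurs twice, and the last factor does
  -- not involve `x i`. So moving `x i` to `y` tests the maximality of the first factor alone.
  have hfac : ∀ (x : Fin (n + 1) → ℝ) (i : Fin (n + 1)), ∏ a, ∏ b, g x a b =
      (∏ j ∈ Finset.univ.erase i, |x i - x j|) ^ 2 *
        ∏ a ∈ Finset.univ.erase i, ∏ b ∈ Finset.univ.erase i, g x a b := by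
    intro x i
    have h1 : ∀ a, ∏ b, g x a b = g x a i * ∏ b ∈ Finset.univ.erase i, g x a b := fun a =>
      (Finset.mul_prod_erase _ _ (Finset.mem_univ i)).symm
    rw [← Finset.mul_prod_erase _ _ (Finset.mem_univ i)]
    simp only [h1]
    rw [Finset.prod_mul_distrib]
    have h2 : ∏ a ∈ Finset.univ.erase i, g x a i = ∏ j ∈ Finset.univ.erase i, |x i - x j| :=
      Finset.prod_congr rfl fun a ha => by
        simp only [hg, if_neg (Finset.ne_of_mem_erase ha), abs_sub_comm]
    have h3 : ∏ a ∈ Finset.univ.erase i, g x i a = ∏ j ∈ Finset.univ.erase i, |x i - x j| :=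
      Finset.prod_congr rfl fun a ha => by
        simp only [hg, if_neg (Finset.ne_of_mem_erase ha).symm]
    have h4 : g x i i = 1 := by simp [hg]
    rw [h2, h3, h4]; ring
  refine ⟨x, hxE, fun a b hab => ?_, fun i y hy => ?_⟩
  · by_contra hne
    have h1 : g x a b = 0 := by simp only [hg, if_neg hne, hab, sub_self, abs_zero]
    rw [Finset.prod_eq_zero (Finset.mem_univ a) (Finset.prod_eq_zero (Finset.mem_univ b) h1)] at hpos
    exact hpos.false
  · have h1 : ∏ a, ∏ b, g (Function.update x i y) a b ≤ ∏ a, ∏ b, g x a b := by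
      apply hmax
      intro j _
      by_cases hj : j = i
      · subst hj; simpa using hy
      · simpa [hj] using hxE j
    rw [hfac _ i, hfac x i] at h1
    rw [hfac x i] at hpos
    have h2 : ∏ a ∈ Finset.univ.erase i, ∏ b ∈ Finset.univ.erase i, g (Function.update x i y) a b =
        ∏ a ∈ Finset.univ.erase i, ∏ b ∈ Finset.univ.erase i, g x a b :=
      Finset.prod_congr rfl fun a ha => Finset.prod_congr rfl fun b hb => by
        simp only [hg, Function.update_of_ne (Finset.ne_of_mem_erase ha),
          Function.update_of_ne (Finset.ne_of_mem_erase hb)]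
    have h3 : ∏ j ∈ Finset.univ.erase i, |Function.update x i y i - Function.update x i y j| =
        ∏ j ∈ Finset.univ.erase i, |y - x j| :=
      Finset.prod_congr rfl fun a ha => by
        rw [Function.update_self, Function.update_of_ne (Finset.ne_of_mem_erase ha)]
    rw [h2, h3] at h1
    have hR : 0 < ∏ a ∈ Finset.univ.erase i, ∏ b ∈ Finset.univ.erase i, g x a b := by
      refine lt_of_le_of_ne (Finset.prod_nonneg fun a _ => Finset.prod_nonneg fun b _ => hg0 x a b) ?_
      intro h; rw [← h, mul_zero] at hpos; exact hpos.false
    exact le_of_sq_le_sq (le_of_mul_le_mul_right h1 hR)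
      (Finset.prod_nonneg fun j _ => abs_nonneg _)

lemma normOP_le_of_forall_le {μ : Measure ℝ} [IsFiniteMeasure μ] (hE : IsCompact μ.support)
    (hμ : IsNondegenerate μ) {n : ℕ} {Q : ℝ[X]} (hQ : Q.Monic) (hn : Q.natDegree = n) {q : ℝ}
    (hq : 0 ≤ q) (h : ∀ x ∈ μ.support, |Q.eval x| ≤ q) :
    normOP μ n ≤ Real.sqrt (μ.real Set.univ) * q := by
  have h1 : normOP μ n ^ 2 ≤ (Real.sqrt (μ.real Set.univ) * q) ^ 2 := by
    rw [normOP_sq, mul_pow, Real.sq_sqrt measureReal_nonneg]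
    refine (integral_monicOP_sq_le hE hμ hQ hn).trans ?_
    calc ∫ x, Q.eval x * Q.eval x ∂μ ≤ ∫ _, q ^ 2 ∂μ := by
          refine integral_mono_ae (integrable_eval_mul hE Q Q) (integrable_const _) ?_
          have hae : ∀ᵐ x ∂μ, x ∈ μ.support := Measure.support_mem_ae
          filter_upwards [hae] with x hx
          rw [← sq, ← sq_abs]
          exact pow_le_pow_left₀ (abs_nonneg _) (h x hx) 2
      _ = _ := by simp
  exact le_of_sq_le_sq h1 (by positivity)

lemma tkern_real_le {d : ℝ} (hd : 0 < d) (m : ℕ) {x y : ℝ} (hxy : x ≠ y) (h : |x - y| ≤ d) :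
    (tkern d m x y : ℝ) ≤ Real.log d - Real.log |x - y| := by
  have hr : 0 < |x - y| := abs_pos.2 (sub_ne_zero.2 hxy)
  have h1 := tkern_le_kern hd m (x : ℂ) y
  have h2 : kern d x y = ENNReal.ofReal (Real.log d - Real.log |x - y|) := by
    rw [kern, if_neg (by exact_mod_cast hxy), ← Complex.ofReal_sub, Complex.norm_real,
      Real.norm_eq_abs, Real.log_div hd.ne' hr.ne']
  rw [h2, ← ENNReal.ofReal_coe_nnreal, ENNReal.ofReal_le_ofReal_iff
    (sub_nonneg.2 (Real.log_le_log hr h))] at h1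
  exact h1

/-- The truncated energy of the uniform probability measure on finitely many points. -/
lemma lintegral_tkern_uniform (d : ℝ) (m : ℕ) {n : ℕ} (x : Fin (n + 1) → ℝ) {E : Set ℝ}
    (hx : ∀ i, x i ∈ E) : ∃ ν : Measure ℂ, IsProbabilityOn ((fun x : ℝ => (x : ℂ)) '' E) ν ∧
      ∫⁻ z, ∫⁻ w, (tkern d m z w : ℝ≥0∞) ∂ν ∂ν =
        ENNReal.ofReal ((∑ i, ∑ j, (tkern d m (x i) (x j) : ℝ)) / (n + 1) ^ 2) := by
  have hn0 : (n + 1 : ℝ≥0∞) ≠ 0 := by simp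
  have hnt : (n + 1 : ℝ≥0∞) ≠ ⊤ := by finiteness
  refine ⟨(n + 1 : ℝ≥0∞)⁻¹ • ∑ i, Measure.dirac (x i : ℂ), ⟨⟨?_⟩, ?_⟩, ?_⟩
  · simp [ENNReal.inv_mul_cancel hn0 hnt]
  · simp only [Measure.smul_apply, Measure.coe_finsetSum, Finset.sum_apply, smul_eq_mul,
      mul_eq_zero, Finset.sum_eq_zero_iff]
    refine Or.inr fun i _ => ?_
    rw [Measure.dirac_apply, Set.indicator_of_notMem]
    exact fun h => h ⟨x i, hx i, rfl⟩
  · simp only [lintegral_smul_measure, lintegral_finsetSum_measure, lintegral_dirac, smul_eq_mul]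
    rw [ENNReal.ofReal_div_of_pos (by positivity), ENNReal.ofReal_sum_of_nonneg
      fun i _ => Finset.sum_nonneg fun j _ => NNReal.coe_nonneg _, ← Finset.mul_sum, ← mul_assoc,
      ENNReal.div_eq_inv_mul, ENNReal.ofReal_pow (by positivity),
      ENNReal.ofReal_add (by positivity) one_pos.le, ENNReal.ofReal_natCast, ENNReal.ofReal_one, sq,
      ENNReal.mul_inv (Or.inl hn0) (Or.inl hnt)]
    congr 1
    refine Finset.sum_congr rfl fun i _ => ?_
    rw [ENNReal.ofReal_sum_of_nonneg fun j _ => NNReal.coe_nonneg _]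
    simp only [ENNReal.ofReal_coe_nnreal]

/-- The upper bound for the norms of the orthogonal polynomials by the capacity of the support. -/
lemma exists_normOP_le {μ : Measure ℝ} [IsFiniteMeasure μ] (hE : IsCompact μ.support)
    (hμ : IsNondegenerate μ) {d : ℝ} (hd : 0 < d)
    (hEd : ∀ x ∈ μ.support, ∀ y ∈ μ.support, |x - y| ≤ d) {c : ℝ} (hc : 0 ≤ c)
    (h : ∀ ρ, IsProbabilityOn ((fun x : ℝ => (x : ℂ)) '' μ.support) ρ →
      ENNReal.ofReal c < kernEnergy d ρ) :
    ∃ B : ℝ, 0 < B ∧ ∀ n, normOP μ n ≤ B * (d * Real.exp (-c)) ^ n := by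
  have hinf := hμ.infinite_support
  have hM : 0 < μ.real Set.univ := by
    have := hμ 1 one_ne_zero
    simpa using this
  obtain ⟨m, hm⟩ := exists_truncated_energy_gt hd (hE.image Complex.continuous_ofReal) h
  refine ⟨Real.sqrt (μ.real Set.univ) * (m + 1), by positivity, fun n => ?_⟩
  obtain ⟨x, hxE, hxi, hmax⟩ := exists_fekete_points hE hinf n
  have hs := normOP_pos hμ n
  set M := Real.sqrt (μ.real Set.univ)
  have hM' : 0 < M := Real.sqrt_pos.2 hM
  have h1 : ∀ i, Real.log (normOP μ n) ≤ Real.log M + n * Real.log d + Real.log (m + 1) -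
      ∑ j, (tkern d m (x i) (x j) : ℝ) := by
    intro i
    have hq : 0 < ∏ j ∈ Finset.univ.erase i, |x i - x j| := Finset.prod_pos fun j hj =>
      abs_pos.2 (sub_ne_zero.2 fun hij => Finset.ne_of_mem_erase hj (hxi hij).symm)
    -- The competitor for `P_n` has its zeros at all the Fekete points but `x i`; on the support it
    -- is largest at `x i`.
    have hle : normOP μ n ≤ M * ∏ j ∈ Finset.univ.erase i, |x i - x j| := by
      refine normOP_le_of_forall_le hE hμ (Q := ∏ j ∈ Finset.univ.erase i, (X - C (x j)))
        (monic_prod_of_monic _ _ fun a _ => monic_X_sub_C _) ?_ hq.le fun y hy => ?_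
      · rw [natDegree_prod_of_monic _ _ fun a _ => monic_X_sub_C _]
        simp
      · rw [eval_prod, Finset.abs_prod]
        simpa using hmax i y hy
    have hlog := Real.log_le_log hs hle
    rw [Real.log_mul hM'.ne' hq.ne', Real.log_prod (fun j hj => abs_ne_zero.2 (sub_ne_zero.2 fun hij => Finset.ne_of_mem_erase hj (hxi hij).symm))] at hlog
    have hsum : ∑ j ∈ Finset.univ.erase i, Real.log |x i - x j| ≤
        ∑ j ∈ Finset.univ.erase i, (Real.log d - (tkern d m (x i) (x j) : ℝ)) := by
      refine Finset.sum_le_sum fun j hj => ?_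
      have := tkern_real_le hd m (fun hij => Finset.ne_of_mem_erase hj (hxi hij).symm)
        (hEd _ (hxE i) _ (hxE j))
      linarith
    rw [Finset.sum_sub_distrib, Finset.sum_const, Finset.card_erase_of_mem (Finset.mem_univ i),
      Finset.card_univ, Fintype.card_fin, Nat.add_sub_cancel, nsmul_eq_mul] at hsum
    -- Restoring the diagonal term costs at most `log (m + 1)`, independently of `n`; this is the
    -- factor `m + 1` in the constant.
    have hsplit := Finset.add_sum_erase Finset.univ (fun j => (tkern d m (x i) (x j) : ℝ))
      (Finset.mem_univ i)
    have := tkern_le hd m (x i : ℂ) (x i)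
    linarith
  -- Summing over `i` produces the truncated energy of the uniform measure on the Fekete points,
  -- which exceeds `c` by the choice of `m`.
  have h2 := Finset.sum_le_sum fun i (_ : i ∈ Finset.univ) => h1 i
  rw [Finset.sum_sub_distrib] at h2
  simp only [Finset.sum_const, Finset.card_univ, Fintype.card_fin, nsmul_eq_mul] at h2
  obtain ⟨ν, hν, hνe⟩ := lintegral_tkern_uniform d m x hxE
  have h3 := hm ν (hν.mono (Metric.self_subset_cthickening _))
  rw [hνe, ENNReal.ofReal_lt_ofReal_iff_of_nonneg hc, lt_div_iff₀ (by positivity)] at h3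
  push_cast at h2
  have h4 : Real.log (normOP μ n) ≤ Real.log M + Real.log (m + 1) + n * (Real.log d - c) := by
    have h5 : ((n : ℝ) + 1) * Real.log (normOP μ n) ≤
        (n + 1) * (Real.log M + n * Real.log d + Real.log (m + 1) - c * (n + 1)) := by linarith
    have h6 := le_of_mul_le_mul_left h5 (by positivity)
    linarith
  rw [← Real.log_le_log_iff hs (by positivity), Real.log_mul (by positivity) (by positivity),
    Real.log_mul (by positivity) (by positivity), Real.log_pow, Real.log_mul hd.ne'
    (Real.exp_pos _).ne', Real.log_exp]
  linarith

end OrthogonalPolynomials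

namespace PotentialTheory

open scoped NNReal

/-! ### Potentials of weakly convergent measures. -/

/-- A measure of finite energy has a large restriction whose potential is approximated uniformly
on the whole plane by its truncations. -/
lemma exists_restrict_lintegral_kern_le {d : ℝ} (hd : 0 < d) {K : Set ℂ} (hK : IsCompact K)
    {σ : Measure ℂ} (hσ : IsProbabilityOn K σ) (hs : kernEnergy d σ ≠ ⊤) {ε : ℝ≥0∞} (hε : ε ≠ 0)
    (hεt : ε ≠ ⊤) :
    ∃ (m : ℕ) (L : Set ℂ), IsCompact L ∧ L ⊆ K ∧ 2⁻¹ ≤ σ L ∧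
      ∀ z, ∫⁻ w in L, kern (d / (m + 1)) z w ∂σ ≤ ε := by
  have := hσ.1
  have hdm : ∀ m : ℕ, 0 < d / ((m : ℝ) + 1) := fun m => by positivity
  have hsplit : ∀ m : ℕ, ∫⁻ z, ∫⁻ w, (tkern d m z w : ℝ≥0∞) ∂σ ∂σ + kernEnergy (d / (m + 1)) σ =
      kernEnergy d σ := by
    intro m
    rw [lintegral_tkern_prod hd, kernEnergy_eq_prod hd, kernEnergy_eq_prod (hdm m),
      ← lintegral_add_right _ (measurable_kern (hdm m))]
    exact lintegral_congr fun p => (kern_eq_tkern_add hd m p.1 p.2).symm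
  -- The truncated energies increase to the finite full energy, so the energy of the singular part
  -- tends to `0`.
  have hlim : Tendsto (fun m : ℕ => kernEnergy (d / (m + 1)) σ) atTop (𝓝 0) := by
    have h1 := tendsto_atTop_iSup (lintegral_lintegral_tkern_mono hd σ)
    rw [← kernEnergy_eq_iSup hd] at h1
    have h2 := ENNReal.Tendsto.sub (tendsto_const_nhds (x := kernEnergy d σ)) h1 (Or.inl hs)
    rw [tsub_self] at h2
    refine h2.congr fun m => ?_
    refine (ENNReal.eq_sub_of_add_eq ?_ ?_).symm
    · exact ne_top_of_le_ne_top hs ((hsplit m) ▸ le_self_add)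
    · rw [add_comm]; exact hsplit m
  obtain ⟨m, hm⟩ := (hlim.eventually (gt_mem_nhds (show (0 : ℝ≥0∞) < ε * 2⁻¹ from
    pos_iff_ne_zero.2 (mul_ne_zero hε (by simp))))).exists
  -- By Markov's inequality the singular part of the potential is at most `ε` on a set of measure at
  -- least `1/2`.
  set S : Set ℂ := {z | ∫⁻ w, kern (d / (m + 1)) z w ∂σ ≤ ε} with hSdef
  have hS : IsClosed S := isClosed_setOf_lintegral_kern_le (hdm m) σ ε
  have hSc : σ Sᶜ ≤ 2⁻¹ := by
    have h1 := mul_meas_ge_le_lintegral₀ (μ := σ)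
      (measurable_lintegral_kern (hdm m) σ).aemeasurable ε
    have hsub : Sᶜ ⊆ {z | ε ≤ ∫⁻ w, kern (d / (m + 1)) z w ∂σ} := fun z hz =>
      (not_le.1 (show ¬ _ ≤ ε from hz)).le
    have h2 : ε * σ Sᶜ ≤ ε * 2⁻¹ := by
      refine le_trans ?_ (h1.trans hm.le)
      gcongr
    exact (ENNReal.mul_le_mul_iff_right hε hεt).1 h2
  have hL : IsCompact (K ∩ S) := hK.inter_right hS
  have hσL : 2⁻¹ ≤ σ (K ∩ S) := by
    have h1 : σ (K ∩ S)ᶜ ≤ 2⁻¹ := by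
      rw [Set.compl_inter]
      refine (measure_union_le _ _).trans ?_
      rw [hσ.2, zero_add]; exact hSc
    have h2 : σ (K ∩ S) + σ (K ∩ S)ᶜ = 1 := by
      rw [measure_add_measure_compl hL.measurableSet, measure_univ]
    have h3 : (2⁻¹ : ℝ≥0∞) + 2⁻¹ ≤ σ (K ∩ S) + 2⁻¹ := by
      rw [ENNReal.inv_two_add_inv_two, ← h2]; gcongr
    exact (ENNReal.add_le_add_iff_right (by simp)).1 h3
  -- The bound holds on `L`. For any other `z` take the nearest point `z'` of `L`: then `|z' - w| ≤
  -- 2 |z - w|` for `w ∈ L`, and the factor `2` is absorbed by halving `d / (m + 1)`.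
  refine ⟨2 * m + 1, K ∩ S, hL, Set.inter_subset_left, hσL, fun z => ?_⟩
  have hne : (K ∩ S).Nonempty := by
    rw [Set.nonempty_iff_ne_empty]
    intro h; rw [h, measure_empty] at hσL; simp at hσL
  obtain ⟨z', hz', hdist⟩ := hL.exists_infDist_eq_dist hne z
  calc ∫⁻ w in K ∩ S, kern (d / ((2 * m + 1 : ℕ) + 1)) z w ∂σ
      ≤ ∫⁻ w in K ∩ S, kern (d / (m + 1)) z' w ∂σ := by
        apply setLIntegral_mono (measurable_kern_right (hdm m) z') fun w hw => ?_
        have h1 : d / (((2 * m + 1 : ℕ) : ℝ) + 1) = d / (m + 1) / 2 := by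
          push_cast; rw [div_div]; congr 1; ring
        rw [h1]
        apply kern_half_le (hdm m)
        have h2 : dist z z' ≤ dist z w := hdist ▸ Metric.infDist_le_dist_of_mem hw
        rw [dist_eq_norm, dist_eq_norm] at h2
        have h3 : ‖z' - w‖ ≤ ‖z' - z‖ + ‖z - w‖ := norm_sub_le_norm_sub_add_norm_sub _ _ _
        rw [norm_sub_rev z' z] at h3
        linarith
    _ ≤ ∫⁻ w, kern (d / (m + 1)) z' w ∂σ := setLIntegral_le_lintegral _ _
    _ ≤ ε := hz'.2

/-- If the measures `ν j` converge weakly to `ρ`, then their potentials cannot stay larger than a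
bound on the potential of `ρ` on a compact set of positive capacity. -/
lemma kernEnergy_eq_top_of_potential_gt {d : ℝ} (hd : 0 < d) {K : Set ℂ} (hK : IsCompact K)
    {ρ : Measure ℂ} [IsProbabilityMeasure ρ] {ν : ℕ → Measure ℂ} [∀ j, IsProbabilityMeasure (ν j)]
    (hν : ∀ f : ℂ →ᵇ ℝ, Tendsto (fun j => ∫ z, f z ∂(ν j)) atTop (𝓝 (∫ z, f z ∂ρ)))
    {a δ : ℝ≥0∞} (ha : a ≠ ⊤) (hδ : δ ≠ 0) (hδt : δ ≠ ⊤)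
    (hρ : ∀ z ∈ K, ∫⁻ w, kern d z w ∂ρ ≤ a)
    (h : ∀ᶠ j in atTop, ∀ z ∈ K, a + 4 * δ ≤ ∫⁻ w, kern d z w ∂(ν j))
    {σ : Measure ℂ} (hσ : IsProbabilityOn K σ) : kernEnergy d σ = ⊤ := by
  by_contra hs
  have := hσ.1
  obtain ⟨m, L, hL, hLK, hσL, hex⟩ := exists_restrict_lintegral_kern_le hd hK hσ hs hδ hδt
  set τ := σ.restrict L
  have hτ : τ Set.univ = σ L := by simp [τ]
  have hτae : ∀ᵐ z ∂τ, z ∈ L := ae_restrict_mem hL.measurableSet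
  have hdm : 0 < d / ((m : ℝ) + 1) := by positivity
  have hpot : ∀ z, ∫⁻ w, kern d z w ∂τ ≤ ENNReal.ofReal (tpot d m τ z) + δ := by
    intro z
    rw [← lintegral_tkern hd]
    calc ∫⁻ w, kern d z w ∂τ = ∫⁻ w, (tkern d m z w : ℝ≥0∞) + kern (d / (m + 1)) z w ∂τ :=
          lintegral_congr fun w => kern_eq_tkern_add hd m z w
      _ = _ := lintegral_add_right _ (measurable_kern_right hdm z)
      _ ≤ _ := by gcongr; exact hex z
  -- The truncated potential of `τ` is a legitimate test function for weak convergence, and differs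
  -- from the full potential by at most `δ`.
  let u : ℂ →ᵇ ℝ := BoundedContinuousFunction.ofNormedAddCommGroup (tpot d m τ)
    (continuous_tpot hd m τ) (τ.real Set.univ * Real.log (m + 1)) fun z => by
      rw [Real.norm_of_nonneg (tpot_nonneg d m τ z)]; exact tpot_le hd m τ z
  have hu : ∀ κ : Measure ℂ, IsProbabilityMeasure κ →
      ∫⁻ z, ENNReal.ofReal (tpot d m τ z) ∂κ = ENNReal.ofReal (∫ z, u z ∂κ) := fun κ _ =>
    (ofReal_integral_eq_lintegral_ofReal (u.integrable κ)
      (Eventually.of_forall fun z => tpot_nonneg d m τ z)).symm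
  -- Integrate the hypothesis against `τ` and exchange the order of integration.
  have h1 : ∀ᶠ j in atTop, (a + 4 * δ) * σ L ≤ ENNReal.ofReal (∫ z, u z ∂(ν j)) + δ := by
    filter_upwards [h] with j hj
    calc (a + 4 * δ) * σ L = ∫⁻ z, a + 4 * δ ∂τ := by rw [lintegral_const, hτ]
      _ ≤ ∫⁻ z, ∫⁻ w, kern d z w ∂(ν j) ∂τ := by
          apply lintegral_mono_ae
          filter_upwards [hτae] with z hz using hj z (hLK hz)
      _ = ∫⁻ z, ∫⁻ w, kern d z w ∂τ ∂(ν j) := lintegral_kern_swap hd _ _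
      _ ≤ ∫⁻ z, ENNReal.ofReal (tpot d m τ z) + δ ∂(ν j) := lintegral_mono hpot
      _ = _ := by rw [lintegral_add_right _ measurable_const, hu _ inferInstance]; simp
  have h2 : (a + 4 * δ) * σ L ≤ ENNReal.ofReal (∫ z, u z ∂ρ) + δ :=
    ge_of_tendsto ((ENNReal.tendsto_ofReal (hν u)).add_const δ) h1
  have h3 : ENNReal.ofReal (∫ z, u z ∂ρ) ≤ a * σ L := by
    rw [← hu ρ inferInstance]
    calc ∫⁻ z, ENNReal.ofReal (tpot d m τ z) ∂ρ ≤ ∫⁻ z, ∫⁻ w, kern d z w ∂τ ∂ρ := by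
          refine lintegral_mono fun z => ?_
          rw [← lintegral_tkern hd]
          exact lintegral_mono fun w => tkern_le_kern hd m z w
      _ = ∫⁻ z, ∫⁻ w, kern d z w ∂ρ ∂τ := lintegral_kern_swap hd _ _
      _ ≤ ∫⁻ z, a ∂τ := by
          apply lintegral_mono_ae
          filter_upwards [hτae] with z hz using hρ z (hLK hz)
      _ = a * σ L := by rw [lintegral_const, hτ]
  have h4 : a * σ L + 4 * δ * σ L ≤ a * σ L + δ := by
    rw [← add_mul]; exact h2.trans (by gcongr)
  have h5 : 4 * δ * σ L ≤ δ :=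
    (ENNReal.add_le_add_iff_left (ENNReal.mul_ne_top ha (measure_ne_top σ L))).1 h4
  -- As `σ L ≥ 1/2`, this reads `2δ ≤ δ`.
  have h6 : 4 * δ * 2⁻¹ ≤ δ := le_trans (by gcongr) h5
  have h7 : (4 : ℝ≥0∞) * δ * 2⁻¹ = δ + δ := by
    rw [mul_right_comm, show (4 : ℝ≥0∞) = 2 * 2 by norm_num, mul_assoc 2 2,
      ENNReal.mul_inv_cancel (by simp) (by simp), mul_one, two_mul]
  rw [h7] at h6
  exact (ENNReal.lt_add_right hδt hδ).not_ge h6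

/-- Probability measures on finite sets have infinite energy. -/
lemma kernEnergy_eq_top_of_finite (d : ℝ) {K : Set ℂ} (hK : K.Finite)
    {ρ : Measure ℂ} (hρ : IsProbabilityOn K ρ) : kernEnergy d ρ = ⊤ := by
  have := hρ.1
  obtain ⟨z, hz⟩ : ∃ z, ρ {z} ≠ 0 := by
    by_contra! hcon
    have h1 : ρ K = 0 := (measure_null_iff_singleton hK.countable).2 fun z _ => hcon z
    have h2 : ρ Set.univ = 0 := by
      rw [← Set.union_compl_self K]; exact measure_union_null h1 hρ.2
    simp at h2
  rw [eq_top_iff]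
  calc (⊤ : ℝ≥0∞) = ∫⁻ x in {z}, ∫⁻ w in {z}, kern d x w ∂ρ ∂ρ := by
        simp [kern_self, ENNReal.mul_top hz]
    _ ≤ kernEnergy d ρ := by
        refine (setLIntegral_le_lintegral _ _).trans (lintegral_mono fun x => ?_)
        exact setLIntegral_le_lintegral _ _

/-! ### Potentials of the zero counting measures. -/

lemma lintegral_multiset_sum_dirac (s : Multiset ℂ) (f : ℂ → ℝ≥0∞) :
    ∫⁻ z, f z ∂(s.map (fun z => Measure.dirac z)).sum = (s.map f).sum := by
  induction s using Multiset.induction_on with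
  | empty => simp
  | cons a s ih => simp [lintegral_add_measure, ih]

/-- Every factor `d / |x - z|` is at least `1`, so the positive parts add up to the logarithm of the
product. Nonnegativity is carried through the induction because `ENNReal.ofReal` is additive only
there. -/
lemma sum_kern_eq {d : ℝ} (hd : 0 < d) (x : ℂ) (s : Multiset ℂ)
    (h : ∀ z ∈ s, x ≠ z ∧ ‖x - z‖ ≤ d) :
    0 < (s.map fun z => ‖x - z‖).prod ∧
    0 ≤ Multiset.card s * Real.log d - Real.log (s.map fun z => ‖x - z‖).prod ∧
    (s.map (kern d x)).sum =
      ENNReal.ofReal (Multiset.card s * Real.log d - Real.log (s.map fun z => ‖x - z‖).prod) := by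
  induction s using Multiset.induction_on with
  | empty => simp
  | cons a s ih =>
    obtain ⟨h1, h2, h3⟩ := ih fun z hz => h z (Multiset.mem_cons_of_mem hz)
    obtain ⟨h4, h5⟩ := h a (Multiset.mem_cons_self a s)
    have hr : 0 < ‖x - a‖ := norm_pos_iff.2 (sub_ne_zero.2 h4)
    have hl := Real.log_le_log hr h5
    have he : ((Multiset.card (a ::ₘ s) : ℕ) : ℝ) * Real.log d -
        Real.log ((a ::ₘ s).map fun z => ‖x - z‖).prod = Real.log (d / ‖x - a‖) +
          (Multiset.card s * Real.log d - Real.log (s.map fun z => ‖x - z‖).prod) := by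
      rw [Multiset.map_cons, Multiset.prod_cons, Real.log_mul hr.ne' h1.ne',
        Real.log_div hd.ne' hr.ne', Multiset.card_cons]
      push_cast; ring
    have hl' : 0 ≤ Real.log (d / ‖x - a‖) := by rw [Real.log_div hd.ne' hr.ne']; linarith
    refine ⟨?_, ?_, ?_⟩
    · rw [Multiset.map_cons, Multiset.prod_cons]; positivity
    · rw [he]; positivity
    · rw [he, Multiset.map_cons, Multiset.sum_cons, h3, ENNReal.ofReal_add hl' h2, kern, if_neg h4]

end PotentialTheory

namespace OrthogonalPolynomials

open PotentialTheory

lemma card_roots_monicOP (μ : Measure ℝ) (n : ℕ) :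
    Multiset.card ((monicOP μ n).map (algebraMap ℝ ℂ)).roots = n := by
  rw [IsAlgClosed.card_roots_eq_natDegree, natDegree_map, (monicOP_monic_natDegree μ n).2]

lemma lintegral_opZeroMeasure (μ : Measure ℝ) (n : ℕ) (f : ℂ → ℝ≥0∞) :
    ∫⁻ z, f z ∂(opZeroMeasure μ n) =
      (n : ℝ≥0∞)⁻¹ * (((monicOP μ n).map (algebraMap ℝ ℂ)).roots.map f).sum := by
  rw [opZeroMeasure, zeroMeasure, lintegral_smul_measure, lintegral_multiset_sum_dirac,
    natDegree_map, (monicOP_monic_natDegree μ n).2, smul_eq_mul]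

lemma isProbabilityMeasure_opZeroMeasure (μ : Measure ℝ) {n : ℕ} (hn : n ≠ 0) :
    IsProbabilityMeasure (opZeroMeasure μ n) := by
  refine ⟨?_⟩
  rw [← lintegral_one, lintegral_opZeroMeasure]
  simp [card_roots_monicOP, ENNReal.inv_mul_cancel, hn]

lemma norm_eval_monicOP (μ : Measure ℝ) (n : ℕ) (x : ℝ) :
    (((monicOP μ n).map (algebraMap ℝ ℂ)).roots.map fun z => ‖(x : ℂ) - z‖).prod =
      |(monicOP μ n).eval x| := by
  have hm := (monicOP_monic_natDegree μ n).1.map (algebraMap ℝ ℂ)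
  have h1 := (IsAlgClosed.splits ((monicOP μ n).map (algebraMap ℝ ℂ))).eval_eq_prod_roots_of_monic hm (x : ℂ)
  have h2 : ((monicOP μ n).map (algebraMap ℝ ℂ)).eval (x : ℂ) = ((monicOP μ n).eval x : ℝ) := by
    have := eval_map_algebraMap (B := ℂ) (monicOP μ n) (algebraMap ℝ ℂ x)
    rw [aeval_algebraMap_apply] at this
    simpa using this
  rw [← Real.norm_eq_abs, ← Complex.norm_real, ← h2, h1]
  exact (Multiset.prod_hom' _ (normHom : ℂ →*₀ ℝ) _).trans rfl

/-- A point where `P_n` is small has a large potential with respect to the zeros of `P_n`. -/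
lemma le_lintegral_kern_opZeroMeasure {μ : Measure ℝ} [IsFiniteMeasure μ]
    (hE : IsCompact μ.support) (hμ : IsNondegenerate μ) {R d : ℝ} (hd : 0 < d) (hRd : 2 * R ≤ d)
    (hR : ∀ x ∈ μ.support, |x| ≤ R) {n : ℕ} (hn : n ≠ 0) {b : ℝ} (hb : 0 < b) {x : ℝ} (hx : |x| ≤ R)
    (h : |(monicOP μ n).eval x| ≤ b ^ n) :
    ENNReal.ofReal (Real.log (d / b)) ≤ ∫⁻ z, kern d x z ∂(opZeroMeasure μ n) := by
  rw [lintegral_opZeroMeasure]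
  set s := ((monicOP μ n).map (algebraMap ℝ ℂ)).roots with hs
  have hcard : Multiset.card s = n := card_roots_monicOP μ n
  have hnt : (n : ℝ≥0∞)⁻¹ ≠ 0 := by simp
  -- At a zero of `P_n` the potential is infinite.
  by_cases hxs : (x : ℂ) ∈ s
  · obtain ⟨t, ht⟩ := Multiset.exists_cons_of_mem hxs
    rw [ht, Multiset.map_cons, Multiset.sum_cons, kern_self, top_add, ENNReal.mul_top hnt]
    exact le_top
  · obtain ⟨h1, h2, h3⟩ := sum_kern_eq hd (x : ℂ) s fun z hz => by
      refine ⟨fun hxz => hxs (hxz ▸ hz), ?_⟩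
      obtain ⟨a, rfl, ha⟩ := root_monicOP hE hμ hR hz
      rw [← Complex.ofReal_sub, Complex.norm_real, Real.norm_eq_abs]
      exact (abs_sub _ _).trans (by linarith)
    have hn' : (0 : ℝ) < n := by exact_mod_cast Nat.pos_of_ne_zero hn
    rw [h3, ← ENNReal.ofReal_natCast, ← ENNReal.ofReal_inv_of_pos hn',
      ← ENNReal.ofReal_mul (by positivity)]
    apply ENNReal.ofReal_le_ofReal
    rw [norm_eval_monicOP] at h1 ⊢
    have h4 := Real.log_le_log h1 h
    rw [Real.log_pow] at h4
    rw [hcard, Real.log_div hd.ne' hb.ne', inv_mul_eq_div, le_div_iff₀ hn']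
    linarith

/-! ### Pointwise smallness, and passage to n-th roots. -/

/-- Markov's inequality and the Borel-Cantelli lemma for orthogonal polynomials whose norms
decay geometrically. -/
lemma ae_eventually_abs_eval_le {μ : Measure ℝ} [IsFiniteMeasure μ] (hE : IsCompact μ.support)
    {n : ℕ → ℕ} (hn : StrictMono n) {A b B : ℝ} (hA : 0 < A) (hAb : A < b)
    (h : ∀ k, normOP μ (n k) ≤ B * A ^ n k) :
    ∀ᵐ x ∂μ, ∀ᶠ k in atTop, |(monicOP μ (n k)).eval x| ≤ b ^ n k := by
  have hb : 0 < b := hA.trans hAb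
  set q := (A / b) ^ 2 with hq
  have hq0 : 0 ≤ q := by positivity
  have hq1 : q < 1 := by
    rw [hq]; exact pow_lt_one₀ (by positivity) ((div_lt_one hb).2 hAb) two_ne_zero
  have hmeas : ∀ k, μ {x | ¬ |(monicOP μ (n k)).eval x| ≤ b ^ n k} ≤
      ENNReal.ofReal (B ^ 2 * q ^ k) := by
    intro k
    have h1 := mul_meas_ge_le_integral_of_nonneg (μ := μ)
      (f := fun x => (monicOP μ (n k)).eval x * (monicOP μ (n k)).eval x)
      (Eventually.of_forall fun x => mul_self_nonneg _) (integrable_eval_mul hE _ _)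
      ((b ^ n k) ^ 2)
    rw [← normOP_sq] at h1
    have hbk : 0 < (b ^ n k) ^ 2 := by positivity
    have h2 : μ.real {x | (b ^ n k) ^ 2 ≤ (monicOP μ (n k)).eval x * (monicOP μ (n k)).eval x} ≤
        B ^ 2 * q ^ k := by
      rw [mul_comm, ← le_div_iff₀ hbk] at h1
      refine h1.trans ?_
      rw [div_le_iff₀ hbk]
      calc normOP μ (n k) ^ 2 ≤ (B * A ^ n k) ^ 2 :=
            pow_le_pow_left₀ (Real.sqrt_nonneg _) (h k) 2
        _ = B ^ 2 * q ^ n k * (b ^ n k) ^ 2 := by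
            rw [hq, div_pow, div_pow, mul_pow, ← pow_mul, ← pow_mul, ← pow_mul, ← pow_mul,
              mul_comm 2]
            field_simp
        _ ≤ B ^ 2 * q ^ k * (b ^ n k) ^ 2 := by
            -- `n k ≥ k` by strict monotonicity, which makes the bounds summable in `k`.
            have := pow_le_pow_of_le_one hq0 hq1.le (hn.id_le k)
            simp only [id] at this
            gcongr
    refine (measure_mono fun x hx => ?_).trans ((ENNReal.le_ofReal_iff_toReal_le
      (measure_ne_top μ _) (by positivity)).2 h2)
    have hx' : b ^ n k < |(monicOP μ (n k)).eval x| := not_le.1 hx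
    change (b ^ n k) ^ 2 ≤ _
    rw [← sq, ← sq_abs ((monicOP μ (n k)).eval x)]
    exact pow_le_pow_left₀ (by positivity) hx'.le 2
  have hsum : ∑' k, μ {x | ¬ |(monicOP μ (n k)).eval x| ≤ b ^ n k} ≠ ⊤ := by
    refine ne_top_of_le_ne_top ?_ (ENNReal.tsum_le_tsum hmeas)
    rw [← ENNReal.ofReal_tsum_of_nonneg (fun k => by positivity)
      ((summable_geometric_of_lt_one hq0 hq1).mul_left _)]
    exact ENNReal.ofReal_ne_top
  filter_upwards [ae_eventually_notMem hsum] with x hx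
  filter_upwards [hx] with k hk
  simpa using hk

lemma exists_nonneg_bound {μ : Measure ℝ} (hE : IsCompact μ.support) :
    ∃ R : ℝ, 1 ≤ R ∧ ∀ x ∈ μ.support, |x| ≤ R := by
  obtain ⟨R, hR⟩ := hE.isBounded.exists_norm_le
  exact ⟨max R 1, le_max_right _ _, fun x hx => (hR x hx).trans (le_max_left _ _)⟩

/-- A nonzero polynomial that vanishes in `L²(μ)` would force the support into its finite zero set,
which carries no measure of finite energy. -/
lemma isNondegenerate_of_kernEnergy_ne_top {μ : Measure ℝ} [IsFiniteMeasure μ]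
    (hE : IsCompact μ.support) {d : ℝ} {ρ : Measure ℂ}
    (hρ : IsProbabilityOn ((fun x : ℝ => (x : ℂ)) '' μ.support) ρ) (h : kernEnergy d ρ ≠ ⊤) :
    IsNondegenerate μ := by
  intro Q hQ
  refine lt_of_le_of_ne (integral_nonneg fun x => mul_self_nonneg _) fun h0 => h ?_
  have h1 := (integral_eq_zero_iff_of_nonneg (fun x => mul_self_nonneg _)
    (integrable_eval_mul hE Q Q)).1 h0.symm
  have h2 : μ.support ⊆ {x | Q.IsRoot x} := by
    refine Measure.support_subset_of_isClosed ?_ ?_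
    · exact isClosed_singleton.preimage Q.continuous
    · filter_upwards [h1] with x hx
      exact mul_self_eq_zero.1 hx
  exact kernEnergy_eq_top_of_finite d (((finite_setOfPred_isRoot hQ).subset h2).image _) hρ

lemma eventually_jacobiMean_lt {μ : Measure ℝ} [IsFiniteMeasure μ] (hE : IsCompact μ.support)
    (hμ : IsNondegenerate μ) {B q : ℝ} (hB : 0 < B) (hq : 0 < q) (h : ∀ n, normOP μ n ≤ B * q ^ n)
    {C' : ℝ} (hqC : q < C') : ∀ᶠ n in atTop, jacobiMean μ n < C' := by
  have hs := normOP_pos hμ 0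
  have h1 : Tendsto (fun n : ℕ => (B / normOP μ 0) ^ ((1 : ℝ) / n) * q) atTop (𝓝 (1 * q)) := by
    refine Tendsto.mul_const _ ?_
    have := (Real.continuousAt_const_rpow (div_pos hB hs).ne' (b := 0)).tendsto.comp
      tendsto_one_div_atTop_nhds_zero_nat
    simpa [Function.comp_def] using this
  rw [one_mul] at h1
  filter_upwards [h1.eventually (gt_mem_nhds hqC), eventually_ge_atTop 1] with n hn hn1
  refine lt_of_le_of_lt ?_ hn
  have hn0 : n ≠ 0 := by omega
  rw [jacobiMean_eq hE hμ]
  calc (normOP μ n / normOP μ 0) ^ ((1 : ℝ) / n) ≤ (B / normOP μ 0 * q ^ n) ^ ((1 : ℝ) / n) := by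
        apply Real.rpow_le_rpow (div_pos (normOP_pos hμ n) hs).le _ (by positivity)
        rw [div_mul_eq_mul_div]
        gcongr
        exact h n
    _ = _ := by
        rw [Real.mul_rpow (div_pos hB hs).le (by positivity), one_div,
          Real.pow_rpow_inv_natCast hq.le hn0]

lemma normOP_le_of_jacobiMean_le {μ : Measure ℝ} [IsFiniteMeasure μ] (hE : IsCompact μ.support)
    (hμ : IsNondegenerate μ) {n : ℕ} (hn : n ≠ 0) {A : ℝ} (h : jacobiMean μ n ≤ A) :
    normOP μ n ≤ normOP μ 0 * A ^ n := by
  have hs := normOP_pos hμ 0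
  have hr : 0 ≤ normOP μ n / normOP μ 0 := (div_pos (normOP_pos hμ n) hs).le
  rw [jacobiMean_eq hE hμ, one_div] at h
  have h1 := pow_le_pow_left₀ (Real.rpow_nonneg hr _) h n
  rw [Real.rpow_inv_natCast_pow hr hn, div_le_iff₀ hs] at h1
  linarith

end OrthogonalPolynomials

/-! ### The dichotomy. -/

open PotentialTheory OrthogonalPolynomials in
/-- Here `E = μ.support`, regarded as a subset of the complex plane wherever potential theory
enters, and `C(E)` is finite since `E` is compact. -/
theorem theorem2 (μ : Measure ℝ) [IsFiniteMeasure μ] (hE : IsCompact μ.support)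
    (ρ : Measure ℂ) (hρ : IsEquilibriumMeasure ((fun x : ℝ => (x : ℂ)) '' μ.support) ρ)
    (n : ℕ → ℕ) (hn : StrictMono n)
    (hν : ∀ f : ℂ →ᵇ ℝ,
      Tendsto (fun j => ∫ z, f z ∂(opZeroMeasure μ (n j))) atTop (𝓝 (∫ z, f z ∂ρ))) :
    Tendsto (fun j => jacobiMean μ (n j)) atTop
        (𝓝 (compactCapacity ((fun x : ℝ => (x : ℂ)) '' μ.support)).toReal) ∨
      ∃ X : Set ℝ, MeasurableSet X ∧ X ⊆ μ.support ∧
        capacity ((fun x : ℝ => (x : ℂ)) '' X) = 0 ∧ μ Xᶜ = 0 := by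
  obtain ⟨R, hR1, hR⟩ := exists_nonneg_bound hE
  set E : Set ℂ := (fun x : ℝ => (x : ℂ)) '' μ.support with hEdef
  -- The margin over the diameter bound `2 * R` makes `κ` positive, and leaves room for the
  -- neighbourhoods used in `capacity_iUnion_eq_zero`.
  set d : ℝ := 2 * (R + 1) with hddef
  have hd1 : 1 ≤ d := by linarith
  have hd : 0 < d := by linarith
  have hEc : IsCompact E := hE.image Complex.continuous_ofReal
  have hER : E ⊆ Metric.closedBall 0 R := by
    rintro _ ⟨x, hx, rfl⟩
    rw [mem_closedBall_zero_iff, Complex.norm_real]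
    exact hR x hx
  have hE2R : ∀ z ∈ E, ∀ w ∈ E, ‖z - w‖ ≤ 2 * R := fun z hz w hw => by
    have h1 := hER hz
    have h2 := hER hw
    rw [mem_closedBall_zero_iff] at h1 h2
    linarith [norm_sub_le z w]
  have hEd : ∀ z ∈ E, ∀ w ∈ E, ‖z - w‖ ≤ d := fun z hz w hw => by
    linarith [hE2R z hz w hw]
  obtain ⟨hI, hcap, hmin⟩ := hρ.kernEnergy_eq hd1 hEd subset_rfl
  have hρE := hρ.isProbabilityOn
  have := hρE.1
  have hμ := isNondegenerate_of_kernEnergy_ne_top hE hρE hI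
  have hρae : ∀ᵐ z ∂ρ, z ∈ E := hρE.2
  have hpot := lintegral_kern_le_of_mem_real hd hEc
    (fun z hz => by obtain ⟨x, -, rfl⟩ := hz; exact ⟨x, rfl⟩) hEd hρE
    (ae_lintegral_kern_eq hd hρE hI hmin)
  set κ := (kernEnergy d ρ).toReal with hκ
  have hIκ : kernEnergy d ρ = ENNReal.ofReal κ := (ENNReal.ofReal_toReal hI).symm
  have hκ0 : 0 < κ := by
    refine ENNReal.toReal_pos (fun h0 => ?_) hI
    have h1 : 0 < Real.log (d / (2 * R)) := by
      apply Real.log_pos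
      rw [one_lt_div (by linarith)]; linarith
    have h2 : ENNReal.ofReal (Real.log (d / (2 * R))) ≤ kernEnergy d ρ := by
      calc ENNReal.ofReal (Real.log (d / (2 * R))) =
            ∫⁻ _, ∫⁻ _, ENNReal.ofReal (Real.log (d / (2 * R))) ∂ρ ∂ρ := by simp
        _ ≤ kernEnergy d ρ := by
            refine lintegral_mono_ae ?_
            filter_upwards [hρae] with z hz
            refine lintegral_mono_ae ?_
            filter_upwards [hρae] with w hw
            by_cases hzw : z = w
            · rw [hzw, kern_self]; exact le_top
            have hr : 0 < ‖z - w‖ := norm_pos_iff.2 (sub_ne_zero.2 hzw)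
            rw [kern, if_neg hzw]
            have := hE2R z hz w hw
            gcongr
    rw [h0, nonpos_iff_eq_zero, ENNReal.ofReal_eq_zero] at h2
    linarith
  set cap : ℝ := d * Real.exp (-κ) with hcapdef
  have hcap0 : 0 < cap := by positivity
  rw [hcap, ENNReal.toReal_ofReal hcap0.le]
  have hupper : ∀ C' > cap, ∀ᶠ j in atTop, jacobiMean μ (n j) < C' := by
    intro C' hC'
    have hcont : Tendsto (fun c => d * Real.exp (-c)) (𝓝[<] κ) (𝓝 cap) :=
      (Continuous.tendsto (by fun_prop) κ).mono_left nhdsWithin_le_nhds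
    -- The norm bound requires `c` strictly below the least energy; by continuity little is lost.
    obtain ⟨c, hcC, hc0, hcκ⟩ := ((hcont.eventually (gt_mem_nhds hC')).and
      (Ioo_mem_nhdsLT hκ0)).exists
    obtain ⟨B, hB, hBn⟩ := exists_normOP_le hE hμ hd (fun x hx y hy => by
      have := hEd _ ⟨x, hx, rfl⟩ _ ⟨y, hy, rfl⟩
      rwa [← Complex.ofReal_sub, Complex.norm_real] at this) hc0.le
      (fun σ hσ => lt_of_lt_of_le (by rw [hIκ]; exact (ENNReal.ofReal_lt_ofReal_iff hκ0).2 hcκ)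
        (hmin σ hσ))
    exact hn.tendsto_atTop.eventually (eventually_jacobiMean_lt hE hμ hB (by positivity) hBn hcC)
  by_cases hlower : ∀ a < cap, ∀ᶠ j in atTop, a < jacobiMean μ (n j)
  · exact Or.inl (tendsto_order.2 ⟨hlower, hupper⟩)
  right
  push Not at hlower
  obtain ⟨a, ha, hfreq⟩ := hlower
  -- The number `a` may be negative; the maximum makes `A` positive and keeps it below `cap`.
  set A := max a (cap / 2) with hA
  have hA0 : 0 < A := lt_max_of_lt_right (by positivity)
  have hAC : A < cap := max_lt ha (by linarith)
  -- The condition `1 ≤ φ k` excludes degree `0`, for which the zero measure is not a probability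
  -- measure.
  obtain ⟨φ, hφ, hφP⟩ := extraction_of_frequently_atTop
    (hfreq.and_eventually (eventually_ge_atTop 1))
  have hnφ : StrictMono (n ∘ φ) := hn.comp hφ
  have hn0 : ∀ k, (n ∘ φ) k ≠ 0 := fun k => by
    have h1 := hn.id_le (φ k)
    have h2 := (hφP k).2
    simp only [id, Function.comp] at h1 ⊢
    omega
  set b := (A + cap) / 2 with hb
  have hAb : A < b := by linarith
  have hbC : b < cap := by linarith
  have hb0 : 0 < b := hA0.trans hAb
  have hdecay := ae_eventually_abs_eval_le hE hnφ hA0 hAb fun k =>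
    normOP_le_of_jacobiMean_le hE hμ (hn0 k) ((hφP k).1.trans (le_max_left _ _))
  -- The smallness holds from index `N` on; each `X N` is compact, so the union is Borel.
  set X : ℕ → Set ℝ := fun N =>
    μ.support ∩ ⋂ k, {x | N ≤ k → |(monicOP μ ((n ∘ φ) k)).eval x| ≤ b ^ (n ∘ φ) k} with hX
  have hXc : ∀ N, IsCompact (X N) := fun N => by
    refine hE.inter_right (isClosed_iInter fun k => ?_)
    by_cases hk : N ≤ k
    · simp only [hk, forall_true_left]
      exact isClosed_le (Polynomial.continuous _).abs continuous_const
    · simp [hk]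
  refine ⟨⋃ N, X N, MeasurableSet.iUnion fun N => (hXc N).measurableSet,
    Set.iUnion_subset fun N => Set.inter_subset_left, ?_, ?_⟩
  · rw [Set.image_iUnion]
    refine capacity_iUnion_eq_zero hd1 le_rfl
      (fun N => (hXc N).image Complex.continuous_ofReal)
      (fun N => (Set.image_mono Set.inter_subset_left).trans hER) fun N σ hσ => ?_
    have hlog : κ < Real.log (d / b) := by
      rw [Real.lt_log_iff_exp_lt (by positivity), lt_div_iff₀ hb0]
      calc Real.exp κ * b < Real.exp κ * cap := by gcongr
        _ = d := by rw [hcapdef, mul_left_comm, ← Real.exp_add]; simp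
    have hprob : ∀ k, IsProbabilityMeasure (opZeroMeasure μ ((n ∘ φ) k)) := fun k =>
      isProbabilityMeasure_opZeroMeasure μ (hn0 k)
    -- With this `δ`, the threshold `κ + 4δ` equals `log (d / b)`, the lower bound for the
    -- potentials of the zeros on `X N`.
    refine kernEnergy_eq_top_of_potential_gt hd ((hXc N).image Complex.continuous_ofReal)
      (ν := fun k => opZeroMeasure μ ((n ∘ φ) k)) (ρ := ρ)
      (fun f => (hν f).comp hφ.tendsto_atTop) (a := ENNReal.ofReal κ)
      (δ := ENNReal.ofReal ((Real.log (d / b) - κ) / 4)) ENNReal.ofReal_ne_top ?_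
      ENNReal.ofReal_ne_top ?_ ?_ hσ
    · rw [Ne, ENNReal.ofReal_eq_zero]; linarith
    · intro z hz
      rw [← hIκ]
      exact hpot z (Set.image_mono Set.inter_subset_left hz)
    · filter_upwards [eventually_ge_atTop N] with k hk
      rintro _ ⟨x, hx, rfl⟩
      have h1 := le_lintegral_kern_opZeroMeasure hE hμ hd (by linarith : 2 * R ≤ d) hR (hn0 k) hb0
        (hR x hx.1) (Set.mem_iInter.1 hx.2 k hk)
      refine le_trans (le_of_eq ?_) h1
      rw [show (4 : ℝ≥0∞) = ENNReal.ofReal 4 by simp, ← ENNReal.ofReal_mul (by norm_num),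
        ← ENNReal.ofReal_add hκ0.le (by linarith)]
      congr 1; ring
  · have hae : ∀ᵐ x ∂μ, x ∈ μ.support := Measure.support_mem_ae
    have : ∀ᵐ x ∂μ, x ∈ ⋃ N, X N := by
      filter_upwards [hae, hdecay] with x hx hxd
      obtain ⟨N, hN⟩ := eventually_atTop.1 hxd
      exact Set.mem_iUnion.2 ⟨N, hx, Set.mem_iInter.2 fun k hk => hN k hk⟩
    exact this
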